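/- Let $\mathcal B$ be a unital complex $*$-algebra and let $(\mathcal B,\mathcal H,D,J)$ be a real spectral triple: $\mathcal B$ is represented on the Hilbert space $\mathcal H$ by bounded operators, $D$ is selfadjoint with compact resolvent, every $b\in\mathcal B$ preserves $\mathrm{Dom}(D)$ and $[D,b]$ extends to a bounded operator on $\mathcal H$, $J$ is antiunitary with $J^2=\varepsilon$ and $JD=\varepsilon' DJ$ for signs $\varepsilon,\varepsilon'\in\{\pm1\}$, and $[a,Jb^*J^{-1}]=0$, $[[D,a],Jb^*J^{-1}]=0$ for all $a,b\in\mathcal B$. Put $hb:=Jb^*J^{-1}h$ for $h\in\mathcal H$, $b\in\mathcal B$; let $\Omega^1_D(\mathcal B)$ be the linear span of the operators $a[D,b]$, and put $h\omega:=-\varepsilon' J\omega^*J^{-1}h$ for $\omega\in\Omega^1_D(\mathcal B)$, so that $h[D,b]=D(hb)-(Dh)b$ for $h\in\mathrm{Dom}(D)$. Let $\mathcal H_M$ be a Hilbert space with a $*$-representation of $\mathcal B$, and let $M$ be a vector space of bounded $\mathcal B$-linear maps $m:\mathcal H\to\mathcal H_M$, written $h\mapsto hm$, that is a left $\mathcal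 B$-module under $h(bm):=(hb)m$. Let $\mathcal HM$ be the linear span of the vectors $hm$. Assume that $\mathcal HM$ is dense in $\mathcal H_M$ and that the multiplication map $\mathcal H\otimes_{\mathcal B}M\to\mathcal HM$ is an isomorphism of vector spaces. Let $\Omega^1_D(\mathcal B)\bullet M$ be the linear span of the maps $h\mapsto(h\omega)m$ with $\omega\in\Omega^1_D(\mathcal B)$, $m\in M$. Let $\nabla:M\to\Omega^1_D(\mathcal B)\bullet M$ be a hermitian $D$-connection, that is, a linear map such that $\nabla(bm)=[D,b]m+b\nabla(m)$ for $b\in\mathcal B$, $m\in M$, and such that for all $m_1,m_2\in M$ one has $m_1^\dagger\circ m_2\in J\mathcal BJ^{-1}$ and, writing actions from the right, $$h\nabla(m_2)m_1^\dagger-hm_2\nabla(m_1)^\dagger=D(hm_2m_1^\dagger)-(Dh)m_2m_1^\dagger\qquad\text{for all }h\in\mathrm{Dom}(D).$$ 1. The formula $D_M(hm)=(Dh)m+h\nabla(m)$, for $h\in\mathrm{Dom}(D)$ and $m\in M$, gives a well-defined, densely defined, symmetric and hence closable operator on the linear span $\mathrm{Dom}(D)M$ of the vectors $hm$. Let $D_M$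 also denote its closure. 2. Each $b\in\mathcal B$ preserves $\mathrm{Dom}(D)M$ and the domain of the closure, and there is a bounded operator $C$ on $\mathcal H_M$ that equals $[D_M,b]$ on both; it satisfies $C(hm)=([D,b]h)m$ for all $h\in\mathcal H$, $m\in M$, and $\|[D_M,b]\|=\|C\|\le\|[D,b]\|$. 3. If $M$ is finitely generated over $\mathcal B$ (in particular if $M$ is finite free or finite projective), then the closure $D_M$ is selfadjoint and has compact resolvent. Moreover $D_M$ is then a bounded perturbation of $D$ in the following sense: for generators $m_1,\dots,m_n$ of $M$ there are $\omega_{jk}\in\Omega^1_D(\mathcal B)$ with $\nabla(m_j)=\sum_k\omega_{jk}m_k$; every vector of $\mathrm{Dom}(D)M$ is of the form $\sum_k h_km_k$ with $h_k\in\mathrm{Dom}(D)$; and for all such $h_k$ $$D_M\Big(\sum_k h_km_k\Big)=\sum_k\Big(Dh_k+\sum_j h_j\omega_{jk}\Big)m_k .$$ -/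

import Mathlib

open scoped ComplexConjugate InnerProductSpace

noncomputable section

namespace NCTwist

section Operators

variable {H : Type*} [NormedAddCommGroup H] [InnerProductSpace ℂ H]

/-- `C` is the (everywhere defined, bounded) commutator `[A, a]` of the unbounded operator `A` with
the bounded operator `a`: the operator `a` preserves the domain of `A`, and `C x = A (a x) - a (A x)`
for all `x` in the domain of `A`. If `A` is densely defined, there is at most one such `C`. -/
def IsCommutator (A : H →ₗ.[ℂ] H) (a C : H →L[ℂ] H) : Prop :=
  ∀ x : A.domain, ∃ hx : a (x : H) ∈ A.domain, C (x : H) = A ⟨a (x : H), hx⟩ - a (A x)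

/-- `R` is the bounded two-sided inverse of `A - z`, that is, `z` lies in the resolvent set of `A`
and `R = (A - z)⁻¹`. -/
def IsResolventAt (A : H →ₗ.[ℂ] H) (z : ℂ) (R : H →L[ℂ] H) : Prop :=
  (∀ x : H, ∃ hx : R x ∈ A.domain, A ⟨R x, hx⟩ - z • R x = x) ∧
    ∀ x : A.domain, R (A x - z • (x : H)) = x

/-- `A` has compact resolvent: its resolvent set is not empty, and `(A - z)⁻¹` is compact for every
`z` in the resolvent set. -/
def HasCompactResolvent (A : H →ₗ.[ℂ] H) : Prop :=
  (∃ z R, IsResolventAt A z R) ∧ ∀ z R, IsResolventAt A z R → IsCompactOperator R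

/-- The linear operator `J ∘ A ∘ J⁻¹`, for an antiunitary `J`. -/
def conjBy (J : H ≃ₗᵢ⋆[ℂ] H) (A : H →L[ℂ] H) : H →L[ℂ] H :=
  (J.toContinuousLinearEquiv : H →L⋆[ℂ] H).comp
    (A.comp (J.symm.toContinuousLinearEquiv : H →L⋆[ℂ] H))

@[simp]
theorem conjBy_apply (J : H ≃ₗᵢ⋆[ℂ] H) (A : H →L[ℂ] H) (h : H) :
    conjBy J A h = J (A (J.symm h)) := rfl

end Operators

/-- A real spectral triple `(B, H, D, J)` over the unital `*`-algebra `B`, with signs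
`J ^ 2 = ε` and `J D = ε' D J`. -/
structure RealSpectralTriple (B : Type*) [Ring B] [StarRing B] [Algebra ℂ B] [StarModule ℂ B]
    (H : Type*) [NormedAddCommGroup H] [InnerProductSpace ℂ H] [CompleteSpace H] where
  /-- the representation of `B` on `H` by bounded operators -/
  π : B →⋆ₐ[ℂ] (H →L[ℂ] H)
  /-- the Dirac operator -/
  D : H →ₗ.[ℂ] H
  /-- the reality structure, an antiunitary operator -/
  J : H ≃ₗᵢ⋆[ℂ] H
  /-- the sign of `J ^ 2` -/
  ε : ℤˣ
  /-- the sign in `J D = ε' D J` -/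
  ε' : ℤˣ
  selfAdjoint : IsSelfAdjoint D
  compactResolvent : HasCompactResolvent D
  boundedCommutators : ∀ b : B, ∃ C : H →L[ℂ] H, IsCommutator D (π b) C
  J_sq : ∀ h : H, J (J h) = ε • h
  J_D : ∀ h : D.domain, ∃ hJ : J (h : H) ∈ D.domain, J (D h) = ε' • D ⟨J (h : H), hJ⟩
  /-- the commutant property `[a, J b* J⁻¹] = 0` -/
  commutant : ∀ a b : B, Commute (π a) (conjBy J (π (star b)))
  /-- the order one condition `[[D, a], J b* J⁻¹] = 0` -/
  orderOne : ∀ (a b : B) (C : H →L[ℂ] H), IsCommutator D (π a) C →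
    Commute C (conjBy J (π (star b)))

section Twist

variable {B : Type*} [Ring B] [StarRing B] [Algebra ℂ B] [StarModule ℂ B]
variable {H : Type*} [NormedAddCommGroup H] [InnerProductSpace ℂ H] [CompleteSpace H]
variable {HM : Type*} [NormedAddCommGroup HM] [InnerProductSpace ℂ HM] [CompleteSpace HM]

namespace RealSpectralTriple

variable (T : RealSpectralTriple B H)

/-- The bounded operator `[D, b]`. -/
def comm (b : B) : H →L[ℂ] H := (T.boundedCommutators b).choose

theorem comm_spec (b : B) : IsCommutator T.D (T.π b) (T.comm b) :=
  (T.boundedCommutators b).choose_spec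

/-- The right action `h ↦ h b = J b* J⁻¹ h` of `b` on `H`. -/
def rightMul (b : B) : H →L[ℂ] H := conjBy T.J (T.π (star b))

/-- The one-forms `Ω¹_D(B)`: finite sums of operators `a [D, b]`. -/
def oneForms : Submodule ℂ (H →L[ℂ] H) :=
  Submodule.span ℂ {ω | ∃ a b : B, ω = T.π a * T.comm b}

/-- The right action of a one-form on `H`. If `J D = D J` it is `h ω = - J ω* J⁻¹ h`; for a general
sign `ε'` it is `h ω = - ε' J ω* J⁻¹ h`, which is what `h [D, b] = D (h b) - (D h) b` requires. -/
def rightForm (ω : H →L[ℂ] H) : H →L[ℂ] H :=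
  -(T.ε' • conjBy T.J (ContinuousLinearMap.adjoint ω))

theorem rightMul_one : T.rightMul 1 = ContinuousLinearMap.id ℂ H := by
  ext h; simp [rightMul]

theorem rightMul_zero : T.rightMul 0 = 0 := by
  ext h; simp [rightMul]

theorem rightMul_add (a b : B) : T.rightMul (a + b) = T.rightMul a + T.rightMul b := by
  ext h; simp [rightMul]

theorem rightMul_mul (a b : B) : T.rightMul (a * b) = (T.rightMul b).comp (T.rightMul a) := by
  ext h; simp [rightMul]

end RealSpectralTriple

/-- A space `M` of bounded `B`-linear maps `H → HM`, where `ρ` is a representation of `B` on `HM`.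
It is a left `B`-module under `(b m)(h) = m (h b)`; the products `h m = m h` span a dense subspace
`H M` of `HM`; and the multiplication map `H ⊗_B M → H M` is an isomorphism. -/
structure TwistModule (T : RealSpectralTriple B H) (ρ : B →⋆ₐ[ℂ] (HM →L[ℂ] HM)) where
  /-- the underlying vector space of maps -/
  carrier : Submodule ℂ (H →L[ℂ] HM)
  leftLinear : ∀ m ∈ carrier, ∀ (b : B) (h : H), m (T.π b h) = ρ b (m h)
  smul_mem : ∀ m ∈ carrier, ∀ b : B, m.comp (T.rightMul b) ∈ carrier
  dense : Dense (Submodule.span ℂ {x : HM | ∃ (h : H) (m : carrier), x = m.1 h} : Set HM)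
  /-- The tensor product over the (noncommutative) algebra `B` is the quotient of the tensor product
  over `ℂ` by the span of all `h b ⊗ m - h ⊗ b m`. The multiplication map is onto `H M` by
  definition of `H M`, so it is an isomorphism iff its kernel on `H ⊗_ℂ M` is that span. -/
  mul_iso : LinearMap.ker (TensorProduct.lift (LinearMap.mk₂ ℂ
      (fun (h : H) (m : carrier) => m.1 h)
      (by intros; simp) (by intros; simp) (by intros; simp) (by intros; simp))) =
    Submodule.span ℂ {t | ∃ (h : H) (b : B) (m : carrier),
      t = TensorProduct.tmul ℂ (T.rightMul b h) m -
        TensorProduct.tmul ℂ h (⟨m.1.comp (T.rightMul b), smul_mem m.1 m.2 b⟩ : carrier)}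

namespace TwistModule

variable {T : RealSpectralTriple B H} {ρ : B →⋆ₐ[ℂ] (HM →L[ℂ] HM)} (M : TwistModule T ρ)

/-- The left `B`-module structure `(b m)(h) = m (h b)` on `M`. -/
instance instModule : Module B M.carrier where
  smul b m := ⟨m.1.comp (T.rightMul b), M.smul_mem m.1 m.2 b⟩
  one_smul m := Subtype.ext (by
    change m.1.comp (T.rightMul 1) = m.1
    rw [T.rightMul_one]; rfl)
  mul_smul a b m := Subtype.ext (by
    change m.1.comp (T.rightMul (a * b)) = (m.1.comp (T.rightMul b)).comp (T.rightMul a)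
    rw [T.rightMul_mul]; rfl)
  smul_zero b := Subtype.ext (ContinuousLinearMap.zero_comp _)
  smul_add b m n := Subtype.ext (ContinuousLinearMap.add_comp m.1 n.1 _)
  add_smul a b m := Subtype.ext (by
    change m.1.comp (T.rightMul (a + b)) = m.1.comp (T.rightMul a) + m.1.comp (T.rightMul b)
    rw [T.rightMul_add, ContinuousLinearMap.comp_add])
  zero_smul m := Subtype.ext (by
    change m.1.comp (T.rightMul 0) = 0
    rw [T.rightMul_zero, ContinuousLinearMap.comp_zero])

theorem coe_smul (b : B) (m : M.carrier) :
    ((b • m : M.carrier) : H →L[ℂ] HM) = m.1.comp (T.rightMul b) := rfl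

/-- The space `Ω¹_D(B) • M`, spanned by the compositions `h ↦ (h ω) m`. -/
def formsMul : Submodule ℂ (H →L[ℂ] HM) :=
  Submodule.span ℂ {x | ∃ ω ∈ T.oneForms, ∃ m ∈ M.carrier, x = m.comp (T.rightForm ω)}

end TwistModule

/-- A `D`-connection on `M`: a linear map `∇ : M → Ω¹_D(B) • M` with
`∇ (b m) = [D, b] m + b ∇ m`. -/
structure DConnection {T : RealSpectralTriple B H} {ρ : B →⋆ₐ[ℂ] (HM →L[ℂ] HM)}
    (M : TwistModule T ρ) where
  /-- the map `∇` -/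
  nabla : M.carrier →ₗ[ℂ] (H →L[ℂ] HM)
  nabla_mem : ∀ m, nabla m ∈ M.formsMul
  leibniz : ∀ (b : B) (m : M.carrier),
    nabla (b • m) = m.1.comp (T.rightForm (T.comm b)) + (nabla m).comp (T.rightMul b)

namespace DConnection

variable {T : RealSpectralTriple B H} {ρ : B →⋆ₐ[ℂ] (HM →L[ℂ] HM)} {M : TwistModule T ρ}
variable (N : DConnection M)

/-- Hermitian connections: `m₁† ∘ m₂ ∈ J B J⁻¹`, and, with actions on `h` written from the right,
`h ∇(m₂) m₁† - h m₂ ∇(m₁)† = D (h m₂ m₁†) - (D h) m₂ m₁†` for `h` in the domain of `D`. -/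
structure IsHermitian : Prop where
  adjoint_comp_mem : ∀ m₁ m₂ : M.carrier, ∃ b : B,
    (ContinuousLinearMap.adjoint m₁.1).comp m₂.1 = conjBy T.J (T.π b)
  compat : ∀ (m₁ m₂ : M.carrier) (h : T.D.domain),
    ∃ hd : ContinuousLinearMap.adjoint m₁.1 (m₂.1 (h : H)) ∈ T.D.domain,
      ContinuousLinearMap.adjoint m₁.1 (N.nabla m₂ (h : H))
          - ContinuousLinearMap.adjoint (N.nabla m₁) (m₂.1 (h : H))
        = T.D ⟨ContinuousLinearMap.adjoint m₁.1 (m₂.1 (h : H)), hd⟩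
          - ContinuousLinearMap.adjoint m₁.1 (m₂.1 (T.D h))

/-- The span in `HM × HM` of all pairs `(h m, (D h) m + h ∇(m))` with `h` in the domain of `D` and
`m ∈ M`. -/
def twistedGraph : Submodule ℂ (HM × HM) :=
  Submodule.span ℂ {p | ∃ (h : T.D.domain) (m : M.carrier),
    p = (m.1 (h : H), m.1 (T.D h) + N.nabla m (h : H))}

/-- The twisted operator `h m ↦ (D h) m + h ∇(m)` on its initial domain `Dom(D) M`, as the operator
with graph `twistedGraph` (which is the graph of an operator if the connection is hermitian). -/
def twistedDiracCore : HM →ₗ.[ℂ] HM := N.twistedGraph.toLinearPMap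

/-- The twisted Dirac operator `D_M`: the closure of the operator on `Dom(D) M`. -/
def twistedDirac : HM →ₗ.[ℂ] HM := N.twistedDiracCore.closure

end DConnection

end Twist

end NCTwist

end

noncomputable section

namespace NCTwist

/-! ### Krein's theorem: compactness transported along an operator of dense range. -/

section Compactness

open Filter Topology

/-! The candidate graph is the span of the pairs `(h m, (D h) m + h ∇(m))`. Hermitian compatibility
and the symmetry of `D` give `⟪p.2, q.1⟫ = ⟪p.1, q.2⟫` for any two of its elements. The first
components are dense, so `(0, y)` in the graph forces `y = 0`: the operator is at once well defined,
symmetric and closable.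

In `[D_M, b]` the connection terms cancel and `h m ↦ ([D, b] h) m` remains. Its bound
(`norm_twistMap_le`) uses that `m₁† ∘ m₂` is a right multiplication: an operator `X` commuting with
the right action moves across the inner product of `H_M` as `X*`. Iterating Cauchy–Schwarz on the
powers of `X* X` turns a crude bound into the sharp one, since the constant disappears under `2 ^
k`-th roots (`le_mul_of_sq_le_mul_double`).

For generators `m_k`, the map `V : H ^ n → H_M`, `V (h_k) = ∑ h_k m_k`, has dense range and
satisfies `D_M V = V (D + W)` with `W` a bounded matrix of one-forms. A Neumann series gives, for
large `|Im z|`, a compact `S` with `(D + W - z) S = 1`, so `(D_M - z) V S = V`. Hence `D_M - z` and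
`D_M - conj z` have dense range, which yields resolvents and selfadjointness.

The resolvent satisfies `R V = V S`, but `V` need be neither injective nor surjective, so
compactness of `S` does not pass to `R` directly. Instead `R* R V = V S' S`, with `R* R` selfadjoint
and `S' S` compact, and Krein's theorem (`exists_norm_le_on_orthogonal_of_symmetrizable`) makes `R*
R`, and so `R`, small on subspaces of finite codimension. -/

/-- A sequence with `a m ^ 2 ≤ a 0 * a (2 * m)` that grows at most like `r ^ m` satisfies
`a 1 ≤ r * a 0`. -/
theorem le_mul_of_sq_le_mul_double {a : ℕ → ℝ} {c r : ℝ} (ha : ∀ m, 0 ≤ a m) (hr : 0 ≤ r)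
    (hsq : ∀ m, a m ^ 2 ≤ a 0 * a (2 * m)) (hc : ∀ᶠ m in atTop, a m ≤ c * r ^ m) :
    a 1 ≤ r * a 0 := by
  rcases (ha 0).eq_or_lt with h0 | h0
  · have := hsq 1
    rw [← h0, zero_mul] at this
    rw [← h0, mul_zero]
    exact (pow_eq_zero_iff two_ne_zero).1 (le_antisymm this (sq_nonneg _)) |>.le
  have key : ∀ k : ℕ, a 1 ^ 2 ^ k * a 0 ≤ a 0 ^ 2 ^ k * a (2 ^ k) := by
    intro k
    induction k with
    | zero => simp [mul_comm]
    | succ k ih =>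
      have h1 : (a 1 ^ 2 ^ k * a 0) ^ 2 ≤ (a 0 ^ 2 ^ k * a (2 ^ k)) ^ 2 :=
        pow_le_pow_left₀ (mul_nonneg (pow_nonneg (ha 1) _) (ha 0)) ih 2
      have h2 := mul_le_mul_of_nonneg_left (hsq (2 ^ k)) (sq_nonneg (a 0 ^ 2 ^ k))
      rw [← mul_le_mul_iff_left₀ h0]
      calc a 1 ^ 2 ^ (k + 1) * a 0 * a 0 = (a 1 ^ 2 ^ k * a 0) ^ 2 := by ring
        _ ≤ (a 0 ^ 2 ^ k) ^ 2 * (a (2 ^ k)) ^ 2 := by rw [← mul_pow]; exact h1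
        _ ≤ (a 0 ^ 2 ^ k) ^ 2 * (a 0 * a (2 * 2 ^ k)) := h2
        _ = a 0 ^ 2 ^ (k + 1) * a (2 ^ (k + 1)) * a 0 := by
          rw [show 2 * 2 ^ k = 2 ^ (k + 1) by ring]; ring
  by_contra! hlt
  have h1 : 0 < a 1 := lt_of_le_of_lt (mul_nonneg hr h0.le) hlt
  have hq : r * a 0 / a 1 < 1 := (div_lt_one h1).2 hlt
  have hq0 : 0 ≤ r * a 0 / a 1 := div_nonneg (mul_nonneg hr h0.le) h1.le
  -- If `a 1 > r * a 0`, then `key` and the growth bound give `a 0 ≤ c * q ^ 2 ^ k` with `q < 1`,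
  -- which forces `a 0 = 0`.
  have htend : Tendsto (fun k : ℕ => c * (r * a 0 / a 1) ^ 2 ^ k) atTop (𝓝 (c * 0)) :=
    ((tendsto_pow_atTop_nhds_zero_of_lt_one hq0 hq).comp
      (tendsto_pow_atTop_atTop_of_one_lt one_lt_two)).const_mul c
  have hle : a 0 ≤ c * 0 := by
    refine ge_of_tendsto htend ?_
    filter_upwards [(tendsto_pow_atTop_atTop_of_one_lt one_lt_two).eventually hc] with k hk
    rw [div_pow, mul_div_assoc', le_div_iff₀ (pow_pos h1 _)]
    calc a 0 * a 1 ^ 2 ^ k ≤ a 0 ^ 2 ^ k * a (2 ^ k) := by rw [mul_comm]; exact key k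
      _ ≤ a 0 ^ 2 ^ k * (c * r ^ 2 ^ k) := mul_le_mul_of_nonneg_left hk (pow_nonneg h0.le _)
      _ = c * (r * a 0) ^ 2 ^ k := by rw [mul_pow]; ring
  rw [mul_zero] at hle
  exact absurd hle (not_le.2 h0)

variable {K : Type*} [NormedAddCommGroup K] [InnerProductSpace ℂ K] [CompleteSpace K]
variable {L : Type*} [NormedAddCommGroup L] [InnerProductSpace ℂ L] [CompleteSpace L]

/-- The adjoint of a compact operator has no sequence of linearly independent eigenvectors whose
eigenvalues are bounded away from zero. -/
theorem not_linearIndependent_eigenvectors_adjoint {A : K →L[ℂ] K} (hA : IsCompactOperator A)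
    {ε : ℝ} (hε : 0 < ε) {f : ℕ → K} (hf : LinearIndependent ℂ f) {μ : ℕ → ℂ}
    (hμ : ∀ n, ε ≤ ‖μ n‖) (hAf : ∀ n, ContinuousLinearMap.adjoint A (f n) = μ n • f n) : False := by
  set A' := ContinuousLinearMap.adjoint A with hA'
  set g := InnerProductSpace.gramSchmidtNormed ℂ f with hg
  have hgo : Orthonormal ℂ g := InnerProductSpace.gramSchmidtNormed_orthonormal hf
  have hinv : ∀ s : Set ℕ, ∀ x ∈ Submodule.span ℂ (f '' s), A' x ∈ Submodule.span ℂ (f '' s) := by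
    intro s x hx
    induction hx using Submodule.span_induction with
    | mem x hx =>
      obtain ⟨n, hn, rfl⟩ := hx
      rw [hAf]
      exact Submodule.smul_mem _ _ (Submodule.subset_span ⟨n, hn, rfl⟩)
    | zero => simp
    | add x y _ _ hx hy => rw [map_add]; exact add_mem hx hy
    | smul c x _ hx => rw [map_smul]; exact Submodule.smul_mem _ _ hx
  have hspan : ∀ s : Set ℕ, Submodule.span ℂ (g '' s) =
      Submodule.span ℂ (InnerProductSpace.gramSchmidt ℂ f '' s) :=
    fun s => InnerProductSpace.span_gramSchmidtNormed f s
  have horth : ∀ n, ∀ x ∈ Submodule.span ℂ (f '' Set.Iio n), ⟪g n, x⟫_ℂ = 0 := by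
    intro n x hx
    rw [← InnerProductSpace.span_gramSchmidt_Iio ℂ f n, ← hspan] at hx
    induction hx using Submodule.span_induction with
    | mem x hx =>
      obtain ⟨m, hm, rfl⟩ := hx
      exact hgo.2 (ne_of_gt hm)
    | zero => simp
    | add x y _ _ hx hy => rw [inner_add_right, hx, hy, add_zero]
    | smul c x _ hx => rw [inner_smul_right, hx, mul_zero]
  have hgmem : ∀ {m n}, m < n → g m ∈ Submodule.span ℂ (f '' Set.Iio n) := by
    intro m n hmn
    rw [← InnerProductSpace.span_gramSchmidt_Iio ℂ f n, ← hspan]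
    exact Submodule.subset_span ⟨m, hmn, rfl⟩
  have hlow : ∀ {m n}, m < n → ⟪A (g n), g m⟫_ℂ = 0 := by
    intro m n hmn
    rw [← ContinuousLinearMap.adjoint_inner_right]
    exact horth n _ (hinv _ _ (hgmem hmn))
  have hdiag : ∀ n, ⟪A (g n), g n⟫_ℂ = μ n := by
    intro n
    rw [← ContinuousLinearMap.adjoint_inner_right]
    obtain ⟨c, u, hu, hgn⟩ : ∃ c : ℂ, ∃ u ∈ Submodule.span ℂ (f '' Set.Iio n),
        g n = c • f n + u := by
      set c : ℂ := (‖InnerProductSpace.gramSchmidt ℂ f n‖ : ℂ)⁻¹ with hc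
      refine ⟨c, c • (InnerProductSpace.gramSchmidt ℂ f n - f n),
        Submodule.smul_mem _ _ ?_, ?_⟩
      · rw [InnerProductSpace.gramSchmidt_def ℂ f n, sub_sub_cancel_left,
          ← InnerProductSpace.span_gramSchmidt_Iio ℂ f n]
        refine neg_mem (Submodule.sum_mem _ fun i hi => ?_)
        have h2 := Submodule.starProjection_apply_mem
          (Submodule.span ℂ {InnerProductSpace.gramSchmidt ℂ f i}) (f n)
        refine Submodule.span_mono ?_ h2
        rintro _ rfl
        exact ⟨i, Finset.mem_Iio.1 hi, rfl⟩
      · rw [smul_sub, add_sub_cancel]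
        rfl
    -- In the basis `g` the adjoint is upper triangular with diagonal entries `μ n`.
    have h1 : A' (g n) = μ n • g n + (A' u - μ n • u) := by
      rw [hgn, map_add, map_smul, hAf, smul_add, smul_comm c]
      abel
    rw [← hA', h1, inner_add_right, inner_smul_right,
      horth n _ (sub_mem (hinv _ _ hu) (Submodule.smul_mem _ _ hu)), add_zero,
      inner_self_eq_norm_sq_to_K, hgo.1 n]
    simp
  obtain ⟨C, hC, hCA⟩ := hA.image_closedBall_subset_compact (𝕜₁ := ℂ) (f := (A : K →ₗ[ℂ] K)) 1
  have hmemC : ∀ n, A (g n) ∈ C := fun n =>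
    hCA ⟨g n, by simp [hgo.1 n], rfl⟩
  obtain ⟨x, -, φ, hφ, hx⟩ := hC.tendsto_subseq hmemC
  obtain ⟨N, hN⟩ := Metric.cauchySeq_iff.1 hx.cauchySeq ε hε
  have h1 := hN (N + 1) (Nat.le_succ N) N le_rfl
  have hlt : φ N < φ (N + 1) := hφ (Nat.lt_succ_self N)
  -- For `m < n`, pairing `A (g n) - A (g m)` with the unit vector `g m` leaves only `-μ m`, so the
  -- images stay `ε` apart and no subsequence is Cauchy.
  have h2 : ⟪A (g (φ (N + 1))) - A (g (φ N)), g (φ N)⟫_ℂ = -μ (φ N) := by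
    rw [inner_sub_left, hlow hlt, hdiag, zero_sub]
  have h3 := norm_inner_le_norm (𝕜 := ℂ) (A (g (φ (N + 1))) - A (g (φ N))) (g (φ N))
  rw [h2, norm_neg, hgo.1, mul_one] at h3
  rw [dist_eq_norm] at h1
  exact absurd (lt_of_le_of_lt ((hμ _).trans h3) h1) (lt_irrefl _)

/-- If `B V = V A` with `A` compact and `V` of dense range, then the eigenvectors of the bounded
selfadjoint operator `B` with eigenvalues bounded away from zero span a finite-dimensional space. -/
theorem finiteDimensional_span_eigenvectors {V : K →L[ℂ] L} (hV : DenseRange V) {A : K →L[ℂ] K}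
    (hA : IsCompactOperator A) {B : L →L[ℂ] L} (hB : IsSelfAdjoint B)
    (hVA : ∀ k, B (V k) = V (A k)) {ε : ℝ} (hε : 0 < ε) :
    FiniteDimensional ℂ (Submodule.span ℂ {x : L | ∃ μ : ℂ, ε ≤ ‖μ‖ ∧ B x = μ • x}) := by
  obtain ⟨s, hs, hspan, hli⟩ :=
    exists_linearIndependent ℂ {x : L | ∃ μ : ℂ, ε ≤ ‖μ‖ ∧ B x = μ • x}
  rw [← hspan]
  rcases s.finite_or_infinite with hfin | hinf
  · exact FiniteDimensional.span_of_finite ℂ hfin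
  exfalso
  have := hinf.to_subtype
  let e : ℕ ↪ s := Infinite.natEmbedding s
  have he : LinearIndependent ℂ (fun n => ((e n : s) : L)) := hli.comp e e.injective
  choose μ hμ hBμ using fun n => hs (e n).2
  -- `V*` carries eigenvectors of `B` to eigenvectors of `A*` with the same eigenvalue, and it is
  -- injective because `V` has dense range.
  have hinj : LinearMap.ker (ContinuousLinearMap.adjoint V : L →ₗ[ℂ] K) = ⊥ := by
    rw [LinearMap.ker_eq_bot']
    intro x hx
    refine hV.eq_zero_of_inner_left ℂ ?_
    intro k
    rw [← ContinuousLinearMap.adjoint_inner_left]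
    exact (congrArg (fun y => ⟪y, k⟫_ℂ) hx).trans (inner_zero_left k)
  have hadj : ∀ x, ContinuousLinearMap.adjoint A (ContinuousLinearMap.adjoint V x) =
      ContinuousLinearMap.adjoint V (B x) := by
    intro x
    refine ext_inner_right ℂ fun k => ?_
    rw [ContinuousLinearMap.adjoint_inner_left, ContinuousLinearMap.adjoint_inner_left,
      ContinuousLinearMap.adjoint_inner_left, ← hVA, ← ContinuousLinearMap.adjoint_inner_left,
      hB.adjoint_eq]
  refine not_linearIndependent_eigenvectors_adjoint hA hε
    (he.map' (ContinuousLinearMap.adjoint V : L →ₗ[ℂ] K) hinj) hμ fun n => ?_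
  change ContinuousLinearMap.adjoint A (ContinuousLinearMap.adjoint V (e n : L)) = _
  rw [hadj, hBμ, map_smul]
  rfl

/-- A bounded operator that is small on subspaces of finite codimension is compact. -/
theorem isCompactOperator_of_norm_le_on_orthogonal {T : L →L[ℂ] L}
    (h : ∀ ε : ℝ, 0 < ε → ∃ E : Submodule ℂ L, FiniteDimensional ℂ E ∧
      ∀ x ∈ Eᗮ, ‖T x‖ ≤ ε * ‖x‖) : IsCompactOperator T := by
  have hmem : T ∈ closure {S : L →L[ℂ] L | IsCompactOperator S} := by
    rw [Metric.mem_closure_iff]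
    intro ε hε
    obtain ⟨E, hE, hTE⟩ := h (ε / 2) (half_pos hε)
    refine ⟨T.comp E.starProjection, ?_, ?_⟩
    · have := FiniteDimensional.proper ℂ E
      have : IsCompactOperator (E.orthogonalProjectionOnto : L →L[ℂ] E) :=
        (isCompactOperator_id.comp_clm (E.orthogonalProjectionOnto : L →L[ℂ] E) :)
      exact this.clm_comp (T.comp E.subtypeL)
    · rw [dist_eq_norm]
      refine lt_of_le_of_lt (ContinuousLinearMap.opNorm_le_bound _ (half_pos hε).le fun x => ?_)
        (half_lt_self hε)
      have h1 : (T - T.comp E.starProjection) x = T (x - E.starProjection x) := by simp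
      rw [h1]
      refine (hTE _ (Submodule.sub_starProjection_mem_orthogonal x)).trans ?_
      refine mul_le_mul_of_nonneg_left ?_ (half_pos hε).le
      rw [← Submodule.starProjection_orthogonal_val]
      exact Submodule.norm_starProjection_apply_le _ _
  rwa [isClosed_setOfPred_isCompactOperator.closure_eq] at hmem

/-- If the spectrum of `A` is contained in the disc of radius `ε`, then the powers of `A` eventually
grow at most like `r ^ n`, for every `r > ε`. -/
theorem eventually_norm_pow_le {R : Type*} [NormedRing R] [NormedAlgebra ℂ R] [CompleteSpace R]
    {a : R} {ε r : ℝ} (h : ∀ z ∈ spectrum ℂ a, ‖z‖ ≤ ε) (hε : 0 ≤ ε) (hr : ε < r) :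
    ∀ᶠ n : ℕ in atTop, ‖a ^ n‖ ≤ r ^ n := by
  have hr0 : 0 < r := lt_of_le_of_lt hε hr
  have hrad : spectralRadius ℂ a < ENNReal.ofReal r := by
    refine lt_of_le_of_lt ?_ (ENNReal.ofReal_lt_ofReal_iff hr0 |>.2 hr)
    refine iSup₂_le fun z hz => ?_
    rw [← enorm_eq_nnnorm, ← ofReal_norm]
    exact ENNReal.ofReal_le_ofReal (h z hz)
  filter_upwards [(spectrum.pow_norm_pow_one_div_tendsto_nhds_spectralRadius a).eventually_lt_const
    hrad, eventually_gt_atTop 0] with n hn hn0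
  have h1 : ‖a ^ n‖ ^ (1 / n : ℝ) < r := (ENNReal.ofReal_lt_ofReal_iff hr0).1 hn
  calc ‖a ^ n‖ = (‖a ^ n‖ ^ (1 / n : ℝ)) ^ n := by
        rw [one_div, Real.rpow_inv_natCast_pow (norm_nonneg _) hn0.ne']
    _ ≤ r ^ n := pow_le_pow_left₀ (Real.rpow_nonneg (norm_nonneg _) _) h1.le n

/-- A selfadjoint operator does not increase norms by more than the growth rate of its iterates. -/
theorem norm_apply_le_of_eventually_norm_pow_le {B : L →L[ℂ] L} (hB : IsSelfAdjoint B) {x : L}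
    {c r : ℝ} (hr : 0 ≤ r) (h : ∀ᶠ n : ℕ in atTop, ‖(B ^ n) x‖ ≤ c * r ^ n) :
    ‖B x‖ ≤ r * ‖x‖ := by
  have := le_mul_of_sq_le_mul_double (a := fun n => ‖(B ^ n) x‖) (fun _ => norm_nonneg _) hr
    (fun m => ?_) h
  · simpa using this
  · have h1 : (‖(B ^ m) x‖ : ℂ) ^ 2 = ⟪x, (B ^ (2 * m)) x⟫_ℂ := by
      rw [two_mul, pow_add, mul_apply_eq_comp,
        ← ContinuousLinearMap.adjoint_inner_left, (hB.pow m).adjoint_eq]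
      exact (inner_self_eq_norm_sq_to_K (𝕜 := ℂ) ((B ^ m) x)).symm
    have h2 := norm_inner_le_norm (𝕜 := ℂ) x ((B ^ (2 * m)) x)
    rw [← h1, norm_pow, Complex.norm_real, norm_norm] at h2
    simpa using h2

/-- If the nonzero eigenvalues of the compact operator `T` are contained in the disc of radius `ε`,
then the powers of `T` eventually grow at most like `r ^ n`, for every `r > ε`. -/
theorem eventually_norm_pow_le_of_isCompactOperator {T : K →L[ℂ] K} (hT : IsCompactOperator T)
    {ε r : ℝ} (h : ∀ (z : ℂ) (x : K), x ≠ 0 → T x = z • x → ‖z‖ ≤ ε) (hε : 0 ≤ ε) (hr : ε < r) :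
    ∀ᶠ n : ℕ in atTop, ‖T ^ n‖ ≤ r ^ n := by
  refine eventually_norm_pow_le (fun z hz => ?_) hε hr
  rcases eq_or_ne z 0 with rfl | hz0
  · simpa using hε
  obtain ⟨x, hx, hx0⟩ := ((hT.hasEigenvalue_iff_mem_spectrum hz0).2 hz).exists_hasEigenvector
  exact h z x hx0 (Module.End.mem_eigenspace_iff.1 hx)

/-- Let `B V = V A` with `A` compact and `B` bounded and selfadjoint. On the part of the range of `V`
that is orthogonal to all eigenvectors of `B` with eigenvalues of modulus at least `ε / 2`, the norm
of `B` is at most `ε`. -/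
theorem norm_apply_le_of_symmetrizable {V : K →L[ℂ] L}
    {A : K →L[ℂ] K} (hA : IsCompactOperator A) {B : L →L[ℂ] L} (hB : IsSelfAdjoint B)
    (hVA : ∀ k, B (V k) = V (A k)) {ε : ℝ} (hε : 0 < ε) {k : K}
    (hk : V k ∈ (Submodule.span ℂ {x : L | ∃ μ : ℂ, ε / 2 ≤ ‖μ‖ ∧ B x = μ • x})ᗮ) :
    ‖B (V k)‖ ≤ ε * ‖V k‖ := by
  set E : Submodule ℂ L := Submodule.span ℂ {x : L | ∃ μ : ℂ, ε / 2 ≤ ‖μ‖ ∧ B x = μ • x} with hE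
  have hEB : ∀ x ∈ E, B x ∈ E := by
    intro x hx
    induction hx using Submodule.span_induction with
    | mem x hx =>
      obtain ⟨μ, hμ, hx⟩ := hx
      rw [hx]
      exact Submodule.smul_mem _ _ (Submodule.subset_span ⟨μ, hμ, hx⟩)
    | zero => simp
    | add x y _ _ hx hy => rw [map_add]; exact add_mem hx hy
    | smul c x _ hx => rw [map_smul]; exact Submodule.smul_mem _ _ hx
  have hEB' : ∀ x ∈ Eᗮ, B x ∈ Eᗮ := by
    intro x hx y hy
    rw [← ContinuousLinearMap.adjoint_inner_left, hB.adjoint_eq]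
    exact hx _ (hEB y hy)
  -- replace `A` by an operator whose nonzero eigenvectors are not in the kernel of `V`
  set N : Submodule ℂ K := LinearMap.ker (V : K →ₗ[ℂ] L) with hN
  have : CompleteSpace N := V.isClosed_ker.completeSpace_coe
  have hVN : ∀ k, V (Nᗮ.starProjection k) = V k := by
    intro k
    rw [Submodule.starProjection_orthogonal_val, map_sub, sub_eq_self]
    exact N.starProjection_apply_mem k
  obtain ⟨A₁, hA₁c, hA₁N, hVA₁⟩ : ∃ A₁ : K →L[ℂ] K, IsCompactOperator A₁ ∧
      (∀ k, A₁ k ∈ Nᗮ) ∧ ∀ k, V (A₁ k) = B (V k) :=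
    ⟨Nᗮ.starProjection.comp A, hA.clm_comp Nᗮ.starProjection,
      fun k => Nᗮ.starProjection_apply_mem (A k), fun k => (hVN _).trans (hVA k).symm⟩
  set K₂ : Submodule ℂ K := Eᗮ.comap (V : K →ₗ[ℂ] L) with hK₂
  have hK₂c : IsClosed (K₂ : Set K) := E.isClosed_orthogonal.preimage V.continuous
  have : CompleteSpace K₂ := hK₂c.completeSpace_coe
  have hinv : ∀ k ∈ K₂, (A₁ : K →ₗ[ℂ] K) k ∈ K₂ := by
    intro k hk
    change V (A₁ k) ∈ Eᗮ
    rw [hVA₁]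
    exact hEB' _ hk
  obtain ⟨A₂, hA₂c, hA₂v⟩ : ∃ A₂ : K₂ →L[ℂ] K₂, IsCompactOperator A₂ ∧
      ∀ k : K₂, ((A₂ k : K₂) : K) = A₁ k := by
    have h1 : IsCompactOperator ((A₁ : K →ₗ[ℂ] K).restrict hinv) :=
      IsCompactOperator.restrict (f := (A₁ : K →ₗ[ℂ] K)) hA₁c hinv hK₂c
    exact ⟨ContinuousLinearMap.mkOfIsCompactOperator h1, h1, fun _ => rfl⟩
  -- An eigenvector with `|z| > ε / 2` would have `V k` in both `E` and `Eᗮ`, so `k` would lie in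
  -- both `N` and `Nᗮ`.
  have hspec : ∀ (z : ℂ) (k : K₂), k ≠ 0 → A₂ k = z • k → ‖z‖ ≤ ε / 2 := by
    intro z k hk0 hk
    by_contra! hlt
    have hz0 : z ≠ 0 := fun h => by rw [h, norm_zero] at hlt; linarith
    have hk1 : A₁ (k : K) = z • (k : K) := by
      rw [← hA₂v]
      exact congrArg Subtype.val hk
    have hkN : (k : K) ∈ Nᗮ := by
      rw [← inv_smul_smul₀ hz0 (k : K), ← hk1]
      exact Submodule.smul_mem _ _ (hA₁N _)
    have hVk : V (k : K) = 0 := by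
      have h1 : V (k : K) ∈ E := Submodule.subset_span
        ⟨z, hlt.le, by rw [← hVA₁, hk1, map_smul]⟩
      exact inner_self_eq_zero.1 ((show V (k : K) ∈ Eᗮ from k.2) _ h1)
    have h2 : (k : K) = 0 := inner_self_eq_zero.1 (hkN (k : K) hVk)
    exact hk0 (Subtype.ext h2)
  have hpow : ∀ᶠ n : ℕ in atTop, ‖A₂ ^ n‖ ≤ ε ^ n :=
    eventually_norm_pow_le_of_isCompactOperator hA₂c hspec (half_pos hε).le (half_lt_self hε)
  have hVpow : ∀ (n : ℕ) (k : K₂), (B ^ n) (V (k : K)) = V ((A₂ ^ n) k : K₂) := by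
    intro n
    induction n with
    | zero => intro k; rfl
    | succ n ih =>
      intro k
      rw [pow_succ, pow_succ, mul_apply_eq_comp, mul_apply_eq_comp, ← ih,
        hA₂v, hVA₁]
  -- The constant may depend on `k`: only the growth rate of the iterates enters the conclusion.
  refine norm_apply_le_of_eventually_norm_pow_le hB hε.le (c := ‖V‖ * ‖k‖) ?_
  filter_upwards [hpow] with n hn
  rw [hVpow n ⟨k, hk⟩]
  calc ‖V ((A₂ ^ n) ⟨k, hk⟩ : K₂)‖ ≤ ‖V‖ * ‖(A₂ ^ n) ⟨k, hk⟩‖ := V.le_opNorm _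
    _ ≤ ‖V‖ * (ε ^ n * ‖k‖) := by
      refine mul_le_mul_of_nonneg_left ?_ (norm_nonneg _)
      exact ((A₂ ^ n).le_opNorm _).trans (mul_le_mul_of_nonneg_right hn (norm_nonneg _))
    _ = ‖V‖ * ‖k‖ * ε ^ n := by ring

/-- **Krein's theorem on symmetrizable compact operators.** If `B V = V A` with `A` compact, `B`
bounded and selfadjoint, and `V` of dense range, then `B` is small on subspaces of finite
codimension. -/
theorem exists_norm_le_on_orthogonal_of_symmetrizable {V : K →L[ℂ] L} (hV : DenseRange V)
    {A : K →L[ℂ] K} (hA : IsCompactOperator A) {B : L →L[ℂ] L} (hB : IsSelfAdjoint B)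
    (hVA : ∀ k, B (V k) = V (A k)) {ε : ℝ} (hε : 0 < ε) :
    ∃ E : Submodule ℂ L, FiniteDimensional ℂ E ∧ ∀ x ∈ Eᗮ, ‖B x‖ ≤ ε * ‖x‖ := by
  set E : Submodule ℂ L := Submodule.span ℂ {x : L | ∃ μ : ℂ, ε / 2 ≤ ‖μ‖ ∧ B x = μ • x} with hE
  have hEfin : FiniteDimensional ℂ E :=
    finiteDimensional_span_eigenvectors hV hA hB hVA (half_pos hε)
  refine ⟨E, hEfin, ?_⟩
  have hbound : ∀ k : K, V k ∈ Eᗮ → ‖B (V k)‖ ≤ ε * ‖V k‖ :=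
    fun k hk => norm_apply_le_of_symmetrizable hA hB hVA hε hk
  -- a finite rank correction shows that the range of `V` is dense in `Eᗮ`
  set q : K →ₗ[ℂ] E := (E.orthogonalProjectionOnto : L →ₗ[ℂ] E) ∘ₗ (V : K →ₗ[ℂ] L) with hq
  -- A dense subspace of the finite-dimensional `E` is all of `E`. So `Φ`, the identity minus a
  -- finite rank operator, fixes `Eᗮ` and maps the range of `V` into its intersection with `Eᗮ`.
  have hqs : Function.Surjective q := by
    have hd : DenseRange q := by
      refine DenseRange.comp (g := E.orthogonalProjectionOnto) (f := V) ?_ hV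
        E.orthogonalProjectionOnto.continuous
      exact Function.Surjective.denseRange fun y =>
        ⟨y, E.orthogonalProjectionOnto_mem_subspace_eq_self y⟩
    have hc : IsClosed (LinearMap.range q : Set E) :=
      (LinearMap.range q).closed_of_finiteDimensional
    intro y
    have h1 : y ∈ closure (Set.range q) := hd y
    rw [← LinearMap.coe_range, hc.closure_eq] at h1
    exact h1
  obtain ⟨s, hs⟩ := q.exists_rightInverse_of_surjective (LinearMap.range_eq_top.2 hqs)
  set s' : E →L[ℂ] K := LinearMap.toContinuousLinearMap s with hs'
  set Φ : L →L[ℂ] L :=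
    ContinuousLinearMap.id ℂ L - V.comp (s'.comp E.orthogonalProjectionOnto) with hΦ
  have hΦE : ∀ x ∈ Eᗮ, Φ x = x := by
    intro x hx
    have h1 : E.orthogonalProjectionOnto x = 0 :=
      Submodule.orthogonalProjectionOnto_eq_zero_iff.2 hx
    simp [hΦ, h1]
  have hΦV : ∀ k, ‖B (Φ (V k))‖ ≤ ε * ‖Φ (V k)‖ := by
    intro k
    have h1 : Φ (V k) = V (k - s (q k)) := by
      rw [map_sub]; rfl
    rw [h1]
    refine hbound _ ?_
    rw [← Submodule.orthogonalProjectionOnto_eq_zero_iff]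
    change q (k - s (q k)) = 0
    rw [map_sub, sub_eq_zero]
    exact (LinearMap.congr_fun hs (q k)).symm
  have hall : ∀ x, ‖B (Φ x)‖ ≤ ε * ‖Φ x‖ := by
    intro x
    refine hV.induction_on (p := fun x => ‖B (Φ x)‖ ≤ ε * ‖Φ x‖) x ?_ hΦV
    exact isClosed_le (by fun_prop) (by fun_prop)
  intro x hx
  simpa [hΦE x hx] using hall x

end Compactness

/-! ### Resolvents and selfadjointness of symmetric operators. -/

section SymmetricOperators

variable {H : Type*} [NormedAddCommGroup H] [InnerProductSpace ℂ H]
variable {T : H →ₗ.[ℂ] H}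

/-- Symmetry of an operator, expressed by its graph. -/
theorem inner_eq_of_mem_graph (hT : T.IsFormalAdjoint T) {p q : H × H} (hp : p ∈ T.graph)
    (hq : q ∈ T.graph) : ⟪p.2, q.1⟫_ℂ = ⟪p.1, q.2⟫_ℂ := by
  obtain ⟨x, rfl⟩ := T.mem_graph_iff'.1 hp
  obtain ⟨y, rfl⟩ := T.mem_graph_iff'.1 hq
  exact hT x y

/-- A symmetric operator satisfies `|Im z| ‖x‖ ≤ ‖(T - z) x‖`. -/
theorem abs_im_mul_norm_le (hT : T.IsFormalAdjoint T) (z : ℂ) (x : T.domain) :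
    |z.im| * ‖(x : H)‖ ≤ ‖T x - z • (x : H)‖ := by
  rcases eq_or_ne (x : H) 0 with h0 | h0
  · simp [h0]
  have him : (⟪(x : H), T x⟫_ℂ).im = 0 := by
    rw [← Complex.conj_eq_iff_im, inner_conj_symm]
    exact hT x x
  have h1 : (⟪(x : H), T x - z • (x : H)⟫_ℂ).im = -(z.im * ‖(x : H)‖ ^ 2) := by
    rw [inner_sub_right, inner_smul_right, Complex.sub_im, him, inner_self_eq_norm_sq_to_K]
    simp [← Complex.ofReal_pow]
  have h2 := (Complex.abs_im_le_norm _).trans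
    (norm_inner_le_norm (𝕜 := ℂ) (x : H) (T x - z • (x : H)))
  rw [h1, abs_neg, abs_mul, abs_of_nonneg (sq_nonneg ‖(x : H)‖)] at h2
  refine le_of_mul_le_mul_left ?_ (norm_pos_iff.2 h0)
  linarith [h2]

/-- For a symmetric operator `T` and `z` not real, a bounded right inverse of `T - z` is its
inverse. -/
theorem isResolventAt_of_right_inverse (hT : T.IsFormalAdjoint T) {z : ℂ} (hz : z.im ≠ 0)
    {R : H →L[ℂ] H} (h : ∀ x : H, ∃ hx : R x ∈ T.domain, T ⟨R x, hx⟩ - z • R x = x) :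
    IsResolventAt T z R := by
  refine ⟨h, fun x => ?_⟩
  obtain ⟨hx, hRx⟩ := h (T x - z • (x : H))
  have h1 := abs_im_mul_norm_le hT z (⟨_, hx⟩ - x)
  have h2 : T (⟨_, hx⟩ - x) - z • ((⟨_, hx⟩ - x : T.domain) : H) = 0 := by
    rw [T.map_sub, Submodule.coe_sub, smul_sub, sub_sub_sub_comm, hRx, sub_self]
  rw [h2, norm_zero] at h1
  have h3 : ‖((⟨_, hx⟩ - x : T.domain) : H)‖ = 0 :=
    le_antisymm (nonpos_of_mul_nonpos_right h1 (abs_pos.2 hz)) (norm_nonneg _)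
  exact sub_eq_zero.1 (norm_eq_zero.1 h3)

/-- The resolvents of a symmetric operator at `z` and at its conjugate are formally adjoint. -/
theorem IsResolventAt.inner_eq (hT : T.IsFormalAdjoint T) {z : ℂ} {R R' : H →L[ℂ] H}
    (hR : IsResolventAt T z R) (hR' : IsResolventAt T (conj z) R') (x y : H) :
    ⟪R x, y⟫_ℂ = ⟪x, R' y⟫_ℂ := by
  obtain ⟨hx, hRx⟩ := hR.1 x
  obtain ⟨hy, hRy⟩ := hR'.1 y
  have h1 := hT ⟨R x, hx⟩ ⟨R' y, hy⟩
  change ⟪T ⟨R x, hx⟩, R' y⟫_ℂ = ⟪R x, T ⟨R' y, hy⟩⟫_ℂ at h1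
  rw [sub_eq_iff_eq_add] at hRx hRy
  rw [hRx, hRy, inner_add_left, inner_add_right, inner_smul_left, inner_smul_right] at h1
  exact (add_right_cancel h1).symm

/-- If one resolvent of an operator is compact, then all are. -/
theorem IsResolventAt.isCompactOperator {z w : ℂ} {R R' : H →L[ℂ] H}
    (hR : IsResolventAt T z R) (hR' : IsResolventAt T w R') (hc : IsCompactOperator R) :
    IsCompactOperator R' := by
  have h : R' = R + (w - z) • R.comp R' := by
    ext x
    obtain ⟨hx, hRx⟩ := hR'.1 x
    have h1 := hR.2 ⟨R' x, hx⟩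
    have h2 : T ⟨R' x, hx⟩ - z • R' x = x + (w - z) • R' x := by
      rw [sub_eq_iff_eq_add] at hRx
      rw [sub_smul, hRx]; abel
    change R (T ⟨R' x, hx⟩ - z • R' x) = R' x at h1
    rw [h2, map_add, map_smul] at h1
    exact h1.symm
  rw [h]
  exact hc.add ((hc.comp_clm R').smul (w - z))

section Closure

theorem IsFormalAdjoint.closure (hT : T.IsFormalAdjoint T) (hc : T.IsClosable) :
    T.closure.IsFormalAdjoint T.closure := by
  have h1 : ∀ p ∈ T.graph, ∀ q ∈ T.closure.graph, ⟪p.2, q.1⟫_ℂ = ⟪p.1, q.2⟫_ℂ := by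
    intro p hp q hq
    rw [← hc.graph_closure_eq_closure_graph] at hq
    refine closure_minimal (s := (T.graph : Set (H × H)))
      (t := {q | ⟪p.2, q.1⟫_ℂ = ⟪p.1, q.2⟫_ℂ}) (fun q hq => inner_eq_of_mem_graph hT hp hq)
      (isClosed_eq (by fun_prop) (by fun_prop)) hq
  have h2 : ∀ p ∈ T.closure.graph, ∀ q ∈ T.closure.graph, ⟪p.2, q.1⟫_ℂ = ⟪p.1, q.2⟫_ℂ := by
    intro p hp q hq
    rw [← hc.graph_closure_eq_closure_graph] at hp
    refine closure_minimal (s := (T.graph : Set (H × H)))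
      (t := {p | ⟪p.2, q.1⟫_ℂ = ⟪p.1, q.2⟫_ℂ}) (fun p hp => h1 p hp q hq)
      (isClosed_eq (by fun_prop) (by fun_prop)) hp
  exact fun x y => h2 _ (T.closure.mem_graph x) _ (T.closure.mem_graph y)

variable [CompleteSpace H]

theorem isClosable_of_isFormalAdjoint (hT : T.IsFormalAdjoint T)
    (hd : Dense (T.domain : Set H)) : T.IsClosable :=
  LinearPMap.isClosable_iff_exists_closed_extension.2
    ⟨T.adjoint, LinearPMap.adjoint_isClosed hd, LinearPMap.IsFormalAdjoint.le_adjoint hd hT⟩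

/-- If `T` is symmetric and `T - z` has dense range for some `z` that is not real, then the closure
of `T` has a resolvent at `z`. -/
theorem exists_isResolventAt_closure (hT : T.IsFormalAdjoint T)
    (hd : Dense (T.domain : Set H)) {z : ℂ} (hz : z.im ≠ 0)
    (hr : DenseRange fun x : T.domain => T x - z • (x : H)) :
    ∃ R : H →L[ℂ] H, IsResolventAt T.closure z R ∧ ‖R‖ ≤ |z.im|⁻¹ := by
  have hc := isClosable_of_isFormalAdjoint hT hd
  set e : T.domain →ₗ[ℂ] H := T.toFun - z • T.domain.subtype with he
  have hr' : DenseRange e := hr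
  have hbound : ∀ x : T.domain, ‖T.domain.subtype x‖ ≤ |z.im|⁻¹ * ‖e x‖ := by
    intro x
    rw [← div_eq_inv_mul, le_div_iff₀ (abs_pos.2 hz), mul_comm]
    exact abs_im_mul_norm_le hT z x
  set R : H →L[ℂ] H := T.domain.subtype.extendOfNorm e with hR
  have hRe : ∀ x : T.domain, R (e x) = (x : H) := fun x =>
    LinearMap.extendOfNorm_eq hr' ⟨_, hbound⟩ x
  refine ⟨R, isResolventAt_of_right_inverse (IsFormalAdjoint.closure hT hc) hz fun x => ?_,
    LinearMap.opNorm_extendOfNorm_le hr' (inv_nonneg.2 (abs_nonneg _)) hbound⟩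
  -- This condition on `x` is closed, so it suffices to check it on the dense range of `T - z`.
  have hmem : (R x, x + z • R x) ∈ T.closure.graph := by
    rw [← hc.graph_closure_eq_closure_graph]
    refine hr'.induction_on (p := fun x => (R x, x + z • R x) ∈ T.graph.topologicalClosure) x
      (T.graph.isClosed_topologicalClosure.preimage (by fun_prop)) fun y => ?_
    refine T.graph.le_topologicalClosure ?_
    have h1 : e y + z • R (e y) = T y := by
      rw [hRe]
      exact sub_add_cancel (T y) (z • (y : H))
    rw [h1, hRe]
    exact T.mem_graph y
  obtain ⟨y, hy⟩ := T.closure.mem_graph_iff'.1 hmem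
  obtain ⟨hy1 : (y : H) = R x, hy2 : T.closure y = x + z • R x⟩ := Prod.ext_iff.1 hy
  have hx : R x ∈ T.closure.domain := hy1 ▸ y.2
  refine ⟨hx, ?_⟩
  have h1 : (⟨R x, hx⟩ : T.closure.domain) = y := Subtype.ext hy1.symm
  rw [h1, hy2, add_sub_cancel_right]

/-- A symmetric operator with resolvents at `z` and at its conjugate is selfadjoint. -/
theorem isSelfAdjoint_of_isResolventAt (hT : T.IsFormalAdjoint T)
    (hd : Dense (T.domain : Set H)) {z : ℂ} {R R' : H →L[ℂ] H}
    (hR : IsResolventAt T z R) (hR' : IsResolventAt T (conj z) R') : IsSelfAdjoint T := by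
  have hle := LinearPMap.IsFormalAdjoint.le_adjoint hd hT
  refine (LinearPMap.eq_of_le_of_domain_eq hle (le_antisymm hle.1 fun x hx => ?_)).symm
  obtain ⟨hy, hRy⟩ := hR.1 (T.adjoint ⟨x, hx⟩ - z • x)
  set y := R (T.adjoint ⟨x, hx⟩ - z • x) with hydef
  suffices h : x = y by rw [h]; exact hy
  rw [← sub_eq_zero, ← inner_self_eq_zero (𝕜 := ℂ)]
  obtain ⟨hu, hRu⟩ := hR'.1 (x - y)
  set u := R' (x - y) with hudef
  have h1 := LinearPMap.adjoint_isFormalAdjoint hd ⟨x, hx⟩ ⟨u, hu⟩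
  have h2 := hT ⟨y, hy⟩ ⟨u, hu⟩
  change ⟪T.adjoint ⟨x, hx⟩, u⟫_ℂ = ⟪x, T ⟨u, hu⟩⟫_ℂ at h1
  change ⟪T ⟨y, hy⟩, u⟫_ℂ = ⟪y, T ⟨u, hu⟩⟫_ℂ at h2
  -- The vector `x - y` is killed by `T* - z`, hence orthogonal to the range of `T - conj z`, which
  -- contains `x - y` itself.
  have h3 : ⟪x - y, T ⟨u, hu⟩ - conj z • u⟫_ℂ = 0 := by
    rw [sub_eq_iff_eq_add] at hRy
    have h4 : T ⟨y, hy⟩ = T.adjoint ⟨x, hx⟩ - z • (x - y) := by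
      rw [hRy, smul_sub]; abel
    rw [h4, inner_sub_left, h1, inner_smul_left] at h2
    rw [inner_sub_right, inner_smul_right, inner_sub_left x y (T ⟨u, hu⟩), ← h2]
    ring
  rwa [hRu] at h3

/-- If `T` is selfadjoint and `z` is not real, then `T` has a resolvent at `z`, of norm at most
`1 / |Im z|`. -/
theorem exists_isResolventAt_of_isSelfAdjoint (hT : IsSelfAdjoint T) {z : ℂ} (hz : z.im ≠ 0) :
    ∃ R : H →L[ℂ] H, IsResolventAt T z R ∧ ‖R‖ ≤ |z.im|⁻¹ := by
  have hd := hT.dense_domain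
  have hT' : T.adjoint = T := hT
  have hs : T.IsFormalAdjoint T := by
    have h := LinearPMap.adjoint_isFormalAdjoint hd
    rwa [hT'] at h
  have hcl : T.closure = T := by
    have hc := isClosable_of_isFormalAdjoint hs hd
    refine LinearPMap.eq_of_eq_graph ?_
    rw [← hc.graph_closure_eq_closure_graph]
    exact hT.isClosed.submodule_topologicalClosure_eq
  rw [← hcl]
  refine exists_isResolventAt_closure hs hd hz ?_
  set e : T.domain →ₗ[ℂ] H := T.toFun - z • T.domain.subtype with he
  change DenseRange e
  have htop : (LinearMap.range e).topologicalClosure = ⊤ := by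
    rw [Submodule.topologicalClosure_eq_top_iff, Submodule.eq_bot_iff]
    intro y hy
    have h1 : ∀ x : T.domain, ⟪conj z • y, (x : H)⟫_ℂ = ⟪y, T x⟫_ℂ := by
      intro x
      have h2 : ⟪y, T x - z • (x : H)⟫_ℂ = 0 :=
        (LinearMap.range e).inner_left_of_mem_orthogonal (LinearMap.mem_range_self e x) hy
      rw [inner_sub_right, inner_smul_right, sub_eq_zero] at h2
      rw [h2, inner_smul_left, Complex.conj_conj]
    have hmem : y ∈ T.adjoint.domain := T.mem_adjoint_domain_of_exists y ⟨_, h1⟩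
    have hval : T.adjoint ⟨y, hmem⟩ = conj z • y := LinearPMap.adjoint_apply_eq hd ⟨y, hmem⟩ h1
    -- A vector orthogonal to the range of `T - z` is an eigenvector of `T* = T` for `conj z`, or
    -- zero; symmetry excludes a nonreal eigenvalue.
    have hs' : T.adjoint.IsFormalAdjoint T.adjoint := by rwa [hT']
    have h3 := abs_im_mul_norm_le hs' (conj z) ⟨y, hmem⟩
    rw [hval, sub_self, norm_zero, Complex.conj_im, abs_neg] at h3
    exact norm_eq_zero.1
      (le_antisymm (nonpos_of_mul_nonpos_right h3 (abs_pos.2 hz)) (norm_nonneg _))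
  rw [DenseRange, ← LinearMap.coe_range]
  exact Submodule.dense_iff_topologicalClosure_eq_top.2 htop

end Closure

end SymmetricOperators

/-! ### Bounded commutators, read off graphs. -/

section Commutators

variable {H : Type*} [NormedAddCommGroup H] [InnerProductSpace ℂ H]

theorem exists_apply_eq_of_mem_graph {A : H →ₗ.[ℂ] H} {x y : H} (h : (x, y) ∈ A.graph) :
    ∃ hx : x ∈ A.domain, A ⟨x, hx⟩ = y := by
  obtain ⟨u, hu⟩ := A.mem_graph_iff'.1 h
  obtain ⟨hu1 : (u : H) = x, hu2 : A u = y⟩ := Prod.ext_iff.1 hu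
  subst hu1
  exact ⟨u.2, hu2⟩

theorem isCommutator_of_graph {A : H →ₗ.[ℂ] H} {a C : H →L[ℂ] H}
    (h : ∀ p ∈ A.graph, (a p.1, C p.1 + a p.2) ∈ A.graph) : IsCommutator A a C := by
  intro x
  obtain ⟨hx, hAx⟩ := exists_apply_eq_of_mem_graph (h _ (A.mem_graph x))
  exact ⟨hx, by rw [hAx, add_sub_cancel_right]⟩

/-- The continuous map `p ↦ (a p.1, C p.1 + a p.2)` preserves the graph, hence also its closure. -/
theorem isCommutator_closure_of_graph {A : H →ₗ.[ℂ] H} {a C : H →L[ℂ] H} (hc : A.IsClosable)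
    (h : ∀ p ∈ A.graph, (a p.1, C p.1 + a p.2) ∈ A.graph) : IsCommutator A.closure a C := by
  refine isCommutator_of_graph fun p hp => ?_
  rw [← hc.graph_closure_eq_closure_graph] at hp ⊢
  exact closure_minimal (s := (A.graph : Set (H × H)))
    (t := {p | (a p.1, C p.1 + a p.2) ∈ A.graph.topologicalClosure})
    (fun p hp => A.graph.le_topologicalClosure (h p hp))
    (A.graph.isClosed_topologicalClosure.preimage (by fun_prop)) hp

theorem IsCommutator.unique {A : H →ₗ.[ℂ] H} (hA : Dense (A.domain : Set H))
    {a C C' : H →L[ℂ] H} (hC : IsCommutator A a C) (hC' : IsCommutator A a C') : C = C' := by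
  refine ContinuousLinearMap.ext fun x => ?_
  refine congrFun (Continuous.ext_on hA C.continuous C'.continuous fun x hx => ?_) x
  obtain ⟨h1, h2⟩ := hC ⟨x, hx⟩
  obtain ⟨h3, h4⟩ := hC' ⟨x, hx⟩
  exact h2.trans h4.symm

theorem IsCommutator.mul {A : H →ₗ.[ℂ] H} {a b C C' : H →L[ℂ] H} (hC : IsCommutator A a C)
    (hC' : IsCommutator A b C') : IsCommutator A (a * b) (C * b + a * C') := by
  intro x
  obtain ⟨h1, h2⟩ := hC' x
  obtain ⟨h3, h4⟩ := hC ⟨b x, h1⟩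
  refine ⟨h3, ?_⟩
  change C (b x) + a (C' x) = A ⟨a (b x), h3⟩ - a (b (A x))
  rw [h2]
  change C (b x) = A ⟨a (b x), h3⟩ - a (A ⟨b x, h1⟩) at h4
  rw [h4, map_sub]
  abel

theorem IsCommutator.adjoint_eq_neg [CompleteSpace H] {A : H →ₗ.[ℂ] H}
    (hd : Dense (A.domain : Set H)) (hA : A.IsFormalAdjoint A) {a C C' : H →L[ℂ] H}
    (hC : IsCommutator A a C) (hC' : IsCommutator A (ContinuousLinearMap.adjoint a) C') :
    ContinuousLinearMap.adjoint C = -C' := by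
  refine ContinuousLinearMap.ext fun y => ?_
  refine congrFun (Continuous.ext_on hd (ContinuousLinearMap.adjoint C).continuous
    (-C').continuous fun y hy => ?_) y
  refine hd.eq_of_inner_right (𝕜 := ℂ) fun x hx => ?_
  obtain ⟨h1, h2⟩ := hC ⟨x, hx⟩
  obtain ⟨h3, h4⟩ := hC' ⟨y, hy⟩
  change C x = _ at h2
  change C' y = A ⟨ContinuousLinearMap.adjoint a y, h3⟩ - _ at h4
  have h5 := hA ⟨a x, h1⟩ ⟨y, hy⟩
  have h6 := hA ⟨x, hx⟩ ⟨_, h3⟩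
  change ⟪A ⟨a x, h1⟩, y⟫_ℂ = ⟪a x, A ⟨y, hy⟩⟫_ℂ at h5
  change ⟪A ⟨x, hx⟩, ContinuousLinearMap.adjoint a y⟫_ℂ =
    ⟪x, A ⟨ContinuousLinearMap.adjoint a y, h3⟩⟫_ℂ at h6
  rw [ContinuousLinearMap.adjoint_inner_right] at h6
  rw [ContinuousLinearMap.adjoint_inner_right, neg_apply, inner_neg_right,
    h2, h4, inner_sub_left, inner_sub_right, ContinuousLinearMap.adjoint_inner_right, h5, ← h6]
  ring

end Commutators

/-! ### Left and right actions of the algebra and of one-forms. -/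

section Twist

variable {B : Type*} [Ring B] [StarRing B] [Algebra ℂ B] [StarModule ℂ B]
variable {H : Type*} [NormedAddCommGroup H] [InnerProductSpace ℂ H] [CompleteSpace H]
variable {HM : Type*} [NormedAddCommGroup HM] [InnerProductSpace ℂ HM] [CompleteSpace HM]

namespace RealSpectralTriple

variable (T : RealSpectralTriple B H)

theorem dense_domain : Dense (T.D.domain : Set H) := T.selfAdjoint.dense_domain

theorem isFormalAdjoint : T.D.IsFormalAdjoint T.D := by
  have h := LinearPMap.adjoint_isFormalAdjoint T.dense_domain
  rwa [show T.D.adjoint = T.D from T.selfAdjoint] at h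

theorem comm_eq {b : B} {C : H →L[ℂ] H} (hC : IsCommutator T.D (T.π b) C) : T.comm b = C :=
  (T.comm_spec b).unique T.dense_domain hC

theorem comm_mul (a b : B) : T.comm (a * b) = T.comm a * T.π b + T.π a * T.comm b := by
  refine T.comm_eq ?_
  rw [map_mul]
  exact (T.comm_spec a).mul (T.comm_spec b)

theorem adjoint_π (b : B) : ContinuousLinearMap.adjoint (T.π b) = T.π (star b) :=
  (map_star T.π b).symm

theorem adjoint_comm (b : B) : ContinuousLinearMap.adjoint (T.comm b) = -T.comm (star b) := by
  refine (T.comm_spec b).adjoint_eq_neg T.dense_domain T.isFormalAdjoint ?_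
  rw [adjoint_π]
  exact T.comm_spec (star b)

theorem commute_π_rightMul (a b : B) : Commute (T.π a) (T.rightMul b) := T.commutant a b

theorem commute_comm_rightMul (a b : B) : Commute (T.comm a) (T.rightMul b) :=
  T.orderOne a b _ (T.comm_spec a)

theorem J_symm_apply (h : H) : T.J.symm h = T.ε • T.J h := by
  rw [LinearIsometryEquiv.symm_apply_eq]
  rcases Int.units_eq_one_or T.ε with h1 | h1 <;> simp [h1, T.J_sq]

theorem J_symm_mem_domain {h : H} (hh : h ∈ T.D.domain) : T.J.symm h ∈ T.D.domain := by
  rw [J_symm_apply]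
  obtain ⟨hJ, -⟩ := T.J_D ⟨h, hh⟩
  rcases Int.units_eq_one_or T.ε with h1 | h1
  · rw [h1, one_smul]; exact hJ
  · rw [h1, Units.neg_smul, one_smul]; exact neg_mem hJ

theorem rightMul_mem_domain (b : B) {h : H} (hh : h ∈ T.D.domain) :
    T.rightMul b h ∈ T.D.domain := by
  obtain ⟨h1, -⟩ := T.comm_spec (star b) ⟨_, T.J_symm_mem_domain hh⟩
  exact (T.J_D ⟨_, h1⟩).1

/-- Since `J⁻¹ = ε J`, conjugation by `J` and by `J⁻¹` agree, so `J⁻¹` also exchanges the left and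
right actions. -/
theorem J_symm_π_apply (b : B) (h : H) :
    T.J.symm (T.π b h) = T.rightMul (star b) (T.J.symm h) := by
  rw [rightMul, star_star, conjBy_apply, J_symm_apply, J_symm_apply, J_symm_apply]
  rcases Int.units_eq_one_or T.ε with h1 | h1 <;> simp [h1, T.J_sq]

theorem conjBy_π_apply {A : H →L[ℂ] H} (hA : ∀ b, Commute A (T.rightMul b)) (b : B) (h : H) :
    conjBy T.J A (T.π b h) = T.π b (conjBy T.J A h) := by
  have h1 : A (T.rightMul (star b) (T.J.symm h)) = T.rightMul (star b) (A (T.J.symm h)) :=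
    DFunLike.congr_fun (hA (star b)).eq (T.J.symm h)
  rw [conjBy_apply, conjBy_apply, J_symm_π_apply, h1, ← LinearIsometryEquiv.eq_symm_apply,
    J_symm_π_apply, LinearIsometryEquiv.symm_apply_apply]

/-- Because `(a [D, c])* = -[D, c*] a*`, this reduces to the commutant property and the order one
condition. -/
theorem commute_adjoint_oneForm_rightMul {ω : H →L[ℂ] H} (hω : ω ∈ T.oneForms) (b : B) :
    Commute (ContinuousLinearMap.adjoint ω) (T.rightMul b) := by
  induction hω using Submodule.span_induction with
  | mem x hx =>
    obtain ⟨a, c, rfl⟩ := hx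
    rw [ContinuousLinearMap.mul_def, ContinuousLinearMap.adjoint_comp, adjoint_comm, adjoint_π]
    exact ((T.commute_comm_rightMul (star c) b).neg_left).mul_left
      (T.commute_π_rightMul (star a) b)
  | zero => rw [map_zero]; exact Commute.zero_left _
  | add x y _ _ hx hy => rw [map_add]; exact hx.add_left hy
  | smul c x _ hx => rw [map_smulₛₗ]; exact hx.smul_left _

theorem rightForm_π_apply {ω : H →L[ℂ] H} (hω : ω ∈ T.oneForms) (b : B) (h : H) :
    T.rightForm ω (T.π b h) = T.π b (T.rightForm ω h) := by
  have h1 := T.conjBy_π_apply (T.commute_adjoint_oneForm_rightMul hω) b h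
  change -(T.ε' • conjBy T.J (ContinuousLinearMap.adjoint ω) (T.π b h)) =
    T.π b (-(T.ε' • conjBy T.J (ContinuousLinearMap.adjoint ω) h))
  rw [h1]
  rcases Int.units_eq_one_or T.ε' with h1 | h1 <;> simp [h1]

theorem rightForm_apply (ω : H →L[ℂ] H) (h : H) : T.rightForm ω h =
    -(T.ε' • T.J (ContinuousLinearMap.adjoint ω (T.J.symm h))) := rfl

theorem rightForm_zero : T.rightForm 0 = 0 := by
  ext h
  simp [rightForm_apply]

theorem rightForm_add (ω η : H →L[ℂ] H) :
    T.rightForm (ω + η) = T.rightForm ω + T.rightForm η := by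
  ext h
  simp only [rightForm_apply, map_add, add_apply, smul_add, neg_add]

theorem rightForm_smul (c : ℂ) (ω : H →L[ℂ] H) : T.rightForm (c • ω) = c • T.rightForm ω := by
  ext h
  change -(T.ε' • T.J (ContinuousLinearMap.adjoint (c • ω) (T.J.symm h))) =
    c • -(T.ε' • T.J (ContinuousLinearMap.adjoint ω (T.J.symm h)))
  have h0 : ContinuousLinearMap.adjoint (c • ω) = conj c • ContinuousLinearMap.adjoint ω :=
    map_smulₛₗ _ _ _
  rw [h0, smul_apply, map_smulₛₗ T.J]
  rcases Int.units_eq_one_or T.ε' with h1 | h1 <;> simp [h1]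

theorem rightForm_mul_π (ω : H →L[ℂ] H) (b : B) :
    T.rightForm (ω * T.π b) = (T.rightMul b).comp (T.rightForm ω) := by
  ext h
  change -(T.ε' • T.J (ContinuousLinearMap.adjoint (ω * T.π b) (T.J.symm h))) =
    T.rightMul b (-(T.ε' • T.J (ContinuousLinearMap.adjoint ω (T.J.symm h))))
  rw [ContinuousLinearMap.mul_def, ContinuousLinearMap.adjoint_comp, adjoint_π]
  rcases Int.units_eq_one_or T.ε' with h1 | h1 <;> simp [h1, rightMul]

/-- By the Leibniz rule `a [D, c] b = a [D, c b] - a c [D, b]`. This lets `ω (b m)` be rewritten as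
`(ω b) m` when expanding in generators. -/
theorem mul_π_mem_oneForms {ω : H →L[ℂ] H} (hω : ω ∈ T.oneForms) (b : B) :
    ω * T.π b ∈ T.oneForms := by
  induction hω using Submodule.span_induction with
  | mem x hx =>
    obtain ⟨a, c, rfl⟩ := hx
    have h : T.π a * T.comm c * T.π b = T.π a * T.comm (c * b) - T.π (a * c) * T.comm b := by
      rw [comm_mul, map_mul]; noncomm_ring
    rw [h]
    exact sub_mem (Submodule.subset_span ⟨a, c * b, rfl⟩) (Submodule.subset_span ⟨a * c, b, rfl⟩)
  | zero => rw [zero_mul]; exact zero_mem _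
  | add x y _ _ hx hy => rw [add_mul]; exact add_mem hx hy
  | smul c x _ hx => rw [smul_mul_assoc]; exact Submodule.smul_mem _ _ hx

end RealSpectralTriple

end Twist

/-! ### The twisted operator: bounded induced maps, symmetry, commutators. -/

section Twist

variable {B : Type*} [Ring B] [StarRing B] [Algebra ℂ B] [StarModule ℂ B]
variable {H : Type*} [NormedAddCommGroup H] [InnerProductSpace ℂ H] [CompleteSpace H]
variable {HM : Type*} [NormedAddCommGroup HM] [InnerProductSpace ℂ HM] [CompleteSpace HM]
variable {T : RealSpectralTriple B H} {ρ : B →⋆ₐ[ℂ] (HM →L[ℂ] HM)}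

open TensorProduct

namespace TwistModule

variable (M : TwistModule T ρ)

theorem dense_span_domain : Dense (Submodule.span ℂ
    {x : HM | ∃ (h : T.D.domain) (m : M.carrier), x = m.1 (h : H)} : Set HM) := by
  set S : Submodule ℂ HM := Submodule.span ℂ
    {x : HM | ∃ (h : T.D.domain) (m : M.carrier), x = m.1 (h : H)} with hS
  have h1 : Submodule.span ℂ {x : HM | ∃ (h : H) (m : M.carrier), x = m.1 h} ≤
      S.topologicalClosure := by
    refine Submodule.span_le.2 ?_
    rintro _ ⟨h, m, rfl⟩
    refine closure_minimal (s := (T.D.domain : Set H)) (t := {h | m.1 h ∈ S.topologicalClosure})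
      (fun h hh => S.le_topologicalClosure (Submodule.subset_span ⟨⟨h, hh⟩, m, rfl⟩))
      (S.isClosed_topologicalClosure.preimage m.1.continuous) (T.dense_domain h)
  have h2 := M.dense.mono h1
  intro x
  have h3 : x ∈ closure (closure (S : Set HM)) := h2 x
  rwa [closure_closure] at h3

theorem apply_π_of_mem_formsMul {x : H →L[ℂ] HM} (hx : x ∈ M.formsMul) (b : B) (h : H) :
    x (T.π b h) = ρ b (x h) := by
  induction hx using Submodule.span_induction with
  | mem x hx =>
    obtain ⟨ω, hω, m, hm, rfl⟩ := hx
    rw [ContinuousLinearMap.comp_apply, ContinuousLinearMap.comp_apply, T.rightForm_π_apply hω,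
      M.leftLinear m hm]
  | zero => simp
  | add x y _ _ hx hy => simp [hx, hy]
  | smul c x _ hx => simp [hx]

/-- The map `h ⊗ m ↦ (X h) m`, for an operator `X` on `H`. -/
def twistMap (X : H →L[ℂ] H) : H ⊗[ℂ] M.carrier →ₗ[ℂ] HM :=
  TensorProduct.lift (LinearMap.mk₂ ℂ (fun (h : H) (m : M.carrier) => m.1 (X h))
    (by intros; simp) (by intros; simp) (by intros; simp) (by intros; simp))

@[simp]
theorem twistMap_tmul (X : H →L[ℂ] H) (h : H) (m : M.carrier) :
    M.twistMap X (h ⊗ₜ[ℂ] m) = m.1 (X h) := rfl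

theorem denseRange_twistMap_one : DenseRange (M.twistMap 1) := by
  rw [DenseRange, ← LinearMap.coe_range]
  refine M.dense.mono (Submodule.span_le.2 ?_)
  rintro _ ⟨h, m, rfl⟩
  exact ⟨h ⊗ₜ m, rfl⟩

/-- A crude bound, with `c` depending on the chosen tensor but not on `X`; `norm_twistMap_le`
sharpens it. -/
theorem exists_norm_twistMap_le (t : H ⊗[ℂ] M.carrier) :
    ∃ c : ℝ, 0 ≤ c ∧ ∀ X : H →L[ℂ] H, ‖M.twistMap X t‖ ≤ c * ‖X‖ := by
  induction t using TensorProduct.induction_on with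
  | zero => exact ⟨0, le_rfl, fun X => by simp⟩
  | tmul h m =>
    refine ⟨‖m.1‖ * ‖h‖, by positivity, fun X => ?_⟩
    calc ‖m.1 (X h)‖ ≤ ‖m.1‖ * (‖X‖ * ‖h‖) :=
          (m.1.le_opNorm _).trans (mul_le_mul_of_nonneg_left (X.le_opNorm h) (norm_nonneg _))
      _ = ‖m.1‖ * ‖h‖ * ‖X‖ := by ring
  | add s t hs ht =>
    obtain ⟨c, hc, hs⟩ := hs
    obtain ⟨d, hd, ht⟩ := ht
    refine ⟨c + d, add_nonneg hc hd, fun X => ?_⟩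
    rw [map_add, add_mul]
    exact (norm_add_le _ _).trans (add_le_add (hs X) (ht X))

section Bounded

variable (hM : ∀ m₁ m₂ : M.carrier, ∃ b : B,
  (ContinuousLinearMap.adjoint m₁.1).comp m₂.1 = conjBy T.J (T.π b))
include hM

/-- On elementary tensors the inner product is `⟪(X h) m m'†, Y h'⟫`, and `m m'†` is a right
multiplication, past which `X` can be moved. -/
theorem inner_twistMap {X : H →L[ℂ] H} (hX : ∀ b, Commute X (T.rightMul b)) (Y : H →L[ℂ] H)
    (s t : H ⊗[ℂ] M.carrier) : ⟪M.twistMap X s, M.twistMap Y t⟫_ℂ =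
      ⟪M.twistMap 1 s, M.twistMap (ContinuousLinearMap.adjoint X * Y) t⟫_ℂ := by
  induction s using TensorProduct.induction_on with
  | zero => simp
  | add s s' hs hs' => rw [map_add, map_add, inner_add_left, inner_add_left, hs, hs']
  | tmul h m =>
    induction t using TensorProduct.induction_on with
    | zero => simp
    | add t t' ht ht' => rw [map_add, map_add, inner_add_right, inner_add_right, ht, ht']
    | tmul h' m' =>
      obtain ⟨b, hb⟩ := hM m' m
      have hb' : ∀ k, ContinuousLinearMap.adjoint m'.1 (m.1 k) = T.rightMul (star b) k := by
        intro k
        rw [RealSpectralTriple.rightMul, star_star, ← hb]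
        rfl
      simp only [twistMap_tmul, one_apply_eq_self, mul_apply_eq_comp]
      rw [← ContinuousLinearMap.adjoint_inner_left, ← ContinuousLinearMap.adjoint_inner_left m'.1,
        hb', hb', ContinuousLinearMap.adjoint_inner_right]
      have := DFunLike.congr_fun (hX (star b)).eq h
      rw [mul_apply_eq_comp, mul_apply_eq_comp] at this
      rw [this]

/-- With `S = X* X`, Cauchy–Schwarz gives `‖S ^ m t‖ ^ 2 ≤ ‖t‖ ‖S ^ (2 m) t‖`. Together with the
crude bound this yields `‖S t‖ ≤ ‖S‖ ‖t‖`, and `‖X t‖ ^ 2 ≤ ‖t‖ ‖S t‖` finishes. -/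
theorem norm_twistMap_le {X : H →L[ℂ] H} (hX : ∀ b, Commute X (T.rightMul b))
    (hX' : ∀ b, Commute (ContinuousLinearMap.adjoint X) (T.rightMul b)) (t : H ⊗[ℂ] M.carrier) :
    ‖M.twistMap X t‖ ≤ ‖X‖ * ‖M.twistMap 1 t‖ := by
  set S : H →L[ℂ] H := ContinuousLinearMap.adjoint X * X with hS
  have hSc : ∀ m b, Commute (S ^ m) (T.rightMul b) := fun m b =>
    ((hX' b).mul_left (hX b)).pow_left m
  have hSa : ∀ m, ContinuousLinearMap.adjoint (S ^ m) = S ^ m := by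
    intro m
    have h1 : IsSelfAdjoint S := IsSelfAdjoint.star_mul_self X
    exact (h1.pow m).adjoint_eq
  have hinner : ∀ Y Z : H →L[ℂ] H, ‖⟪M.twistMap Y t, M.twistMap Z t⟫_ℂ‖ ≤
      ‖M.twistMap Y t‖ * ‖M.twistMap Z t‖ := fun Y Z => norm_inner_le_norm _ _
  have hself : ∀ Y : H →L[ℂ] H, ‖⟪M.twistMap Y t, M.twistMap Y t⟫_ℂ‖ = ‖M.twistMap Y t‖ ^ 2 := by
    intro Y
    rw [inner_self_eq_norm_sq_to_K, norm_pow]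
    simp
  obtain ⟨c, hc, hct⟩ := M.exists_norm_twistMap_le t
  have h1 := le_mul_of_sq_le_mul_double (a := fun m => ‖M.twistMap (S ^ m) t‖) (c := c)
    (r := ‖S‖) (fun _ => norm_nonneg _) (norm_nonneg _)
    (fun m => by
      rw [← hself, M.inner_twistMap hM (hSc m), hSa, ← pow_add, ← two_mul, pow_zero]
      exact hinner _ _)
    ((Filter.eventually_gt_atTop 0).mono fun m hm =>
      (hct _).trans (mul_le_mul_of_nonneg_left (norm_pow_le' S hm) hc))
  simp only [pow_one, pow_zero] at h1
  have h2 : ‖M.twistMap X t‖ ^ 2 ≤ ‖M.twistMap 1 t‖ * ‖M.twistMap S t‖ := by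
    rw [← hself, M.inner_twistMap hM hX]
    exact hinner _ _
  have h3 : ‖S‖ = ‖X‖ * ‖X‖ := X.norm_adjoint_comp_self
  rw [h3] at h1
  refine le_of_sq_le_sq ?_ (by positivity)
  calc ‖M.twistMap X t‖ ^ 2 ≤ ‖M.twistMap 1 t‖ * (‖X‖ * ‖X‖ * ‖M.twistMap 1 t‖) :=
        h2.trans (mul_le_mul_of_nonneg_left h1 (norm_nonneg _))
    _ = (‖X‖ * ‖M.twistMap 1 t‖) ^ 2 := by ring

/-- A bounded operator `X` on `H` that commutes, as does its adjoint, with the right action of `B`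
induces the bounded operator `h m ↦ (X h) m` on `HM`. -/
theorem exists_clm_of_commute {X : H →L[ℂ] H} (hX : ∀ b, Commute X (T.rightMul b))
    (hX' : ∀ b, Commute (ContinuousLinearMap.adjoint X) (T.rightMul b)) :
    ∃ C : HM →L[ℂ] HM, (∀ (h : H) (m : M.carrier), C (m.1 h) = m.1 (X h)) ∧ ‖C‖ ≤ ‖X‖ :=
  ⟨(M.twistMap X).extendOfNorm (M.twistMap 1),
    fun h m => LinearMap.extendOfNorm_eq M.denseRange_twistMap_one
      ⟨_, M.norm_twistMap_le hM hX hX'⟩ (h ⊗ₜ m),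
    LinearMap.opNorm_extendOfNorm_le M.denseRange_twistMap_one (norm_nonneg _)
      (M.norm_twistMap_le hM hX hX')⟩

end Bounded

end TwistModule

namespace DConnection

variable {M : TwistModule T ρ} (N : DConnection M)

theorem apply_mem_twistedGraph (h : T.D.domain) (m : M.carrier) :
    (m.1 (h : H), m.1 (T.D h) + N.nabla m (h : H)) ∈ N.twistedGraph :=
  Submodule.subset_span ⟨h, m, rfl⟩

theorem twistedDiracCore_domain : N.twistedDiracCore.domain =
    Submodule.span ℂ {x : HM | ∃ (h : T.D.domain) (m : M.carrier), x = m.1 (h : H)} := by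
  rw [twistedDiracCore, Submodule.toLinearPMap_domain, twistedGraph, Submodule.map_span]
  congr 1
  ext x
  constructor
  · rintro ⟨_, ⟨h, m, rfl⟩, rfl⟩
    exact ⟨h, m, rfl⟩
  · rintro ⟨h, m, rfl⟩
    exact ⟨_, ⟨h, m, rfl⟩, rfl⟩

theorem dense_twistedDiracCore_domain : Dense (N.twistedDiracCore.domain : Set HM) := by
  rw [twistedDiracCore_domain]
  exact M.dense_span_domain

/-- Both `m` and `∇(m)` are `B`-linear, so `b` passes through them and only `[D, b]` is left over.
-/
theorem π_mem_twistedGraph {b : B} {C : HM →L[ℂ] HM}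
    (hC : ∀ (h : H) (m : M.carrier), C (m.1 h) = m.1 (T.comm b h)) {p : HM × HM}
    (hp : p ∈ N.twistedGraph) : (ρ b p.1, C p.1 + ρ b p.2) ∈ N.twistedGraph := by
  induction hp using Submodule.span_induction with
  | mem p hp =>
    obtain ⟨h, m, rfl⟩ := hp
    obtain ⟨hb, hbh⟩ := T.comm_spec b h
    convert N.apply_mem_twistedGraph ⟨_, hb⟩ m using 2
    · exact (M.leftLinear m.1 m.2 b h).symm
    · change C (m.1 (h : H)) + ρ b (m.1 (T.D h) + N.nabla m h) =
        m.1 (T.D ⟨T.π b h, hb⟩) + N.nabla m (T.π b h)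
      rw [hC, hbh, M.apply_π_of_mem_formsMul (N.nabla_mem m), map_sub, M.leftLinear m.1 m.2,
        map_add]
      abel
  | zero =>
    convert N.twistedGraph.zero_mem using 1
    simp
  | add p q _ _ hp hq =>
    convert add_mem hp hq using 1
    simp only [Prod.fst_add, Prod.snd_add, map_add, Prod.mk_add_mk, Prod.mk.injEq, true_and]
    abel
  | smul c p _ hp =>
    convert Submodule.smul_mem _ c hp using 1
    simp

variable {N}

/-- On generators this is the hermitian condition paired with `h'`, after `D` is moved across by
symmetry. -/
theorem IsHermitian.inner_eq (hN : N.IsHermitian) {p q : HM × HM} (hp : p ∈ N.twistedGraph)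
    (hq : q ∈ N.twistedGraph) : ⟪p.2, q.1⟫_ℂ = ⟪p.1, q.2⟫_ℂ := by
  induction hp using Submodule.span_induction with
  | zero => simp
  | add p p' _ _ hp hp' =>
    rw [Prod.snd_add, Prod.fst_add, inner_add_left, inner_add_left, hp, hp']
  | smul c p _ hp => rw [Prod.smul_snd, Prod.smul_fst, inner_smul_left, inner_smul_left, hp]
  | mem p hp =>
    obtain ⟨h, m, rfl⟩ := hp
    induction hq using Submodule.span_induction with
    | zero => simp
    | add q q' _ _ hq hq' =>
      rw [Prod.snd_add, Prod.fst_add, inner_add_right, inner_add_right, hq, hq']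
    | smul c q _ hq => rw [Prod.smul_snd, Prod.smul_fst, inner_smul_right, inner_smul_right, hq]
    | mem q hq =>
      obtain ⟨h', m', rfl⟩ := hq
      obtain ⟨hd, hc⟩ := hN.compat m' m h
      have h1 := T.isFormalAdjoint ⟨_, hd⟩ h'
      have h2 := congrArg (fun x => ⟪x, (h' : H)⟫_ℂ) hc
      change ⟪T.D ⟨_, hd⟩, (h' : H)⟫_ℂ = ⟪ContinuousLinearMap.adjoint m'.1 (m.1 (h : H)), T.D h'⟫_ℂ
        at h1
      simp only [inner_sub_left, h1, ContinuousLinearMap.adjoint_inner_left] at h2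
      change ⟪m.1 (T.D h) + N.nabla m (h : H), m'.1 (h' : H)⟫_ℂ =
        ⟪m.1 (h : H), m'.1 (T.D h') + N.nabla m' (h' : H)⟫_ℂ
      rw [inner_add_left, inner_add_right]
      linear_combination h2

/-- Single-valuedness: if `(0, y)` is in the span, symmetry makes `y` orthogonal to the dense
domain. -/
theorem IsHermitian.graph_twistedDiracCore (hN : N.IsHermitian) :
    N.twistedDiracCore.graph = N.twistedGraph := by
  refine Submodule.toLinearPMap_graph_eq _ fun p hp hp0 => ?_
  refine N.dense_twistedDiracCore_domain.eq_zero_of_inner_left (𝕜 := ℂ) fun x hx => ?_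
  obtain ⟨q, hq, rfl⟩ : ∃ q ∈ N.twistedGraph, q.1 = x := hx
  rw [hN.inner_eq hp hq, hp0, inner_zero_left]

theorem IsHermitian.isFormalAdjoint (hN : N.IsHermitian) :
    N.twistedDiracCore.IsFormalAdjoint N.twistedDiracCore := by
  intro x y
  have hx := N.twistedDiracCore.mem_graph x
  have hy := N.twistedDiracCore.mem_graph y
  rw [hN.graph_twistedDiracCore] at hx hy
  exact hN.inner_eq hx hy

theorem IsHermitian.isClosable (hN : N.IsHermitian) : N.twistedDiracCore.IsClosable :=
  isClosable_of_isFormalAdjoint hN.isFormalAdjoint N.dense_twistedDiracCore_domain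

theorem IsHermitian.apply (hN : N.IsHermitian) (h : T.D.domain) (m : M.carrier) :
    ∃ hx : m.1 (h : H) ∈ N.twistedDiracCore.domain,
      N.twistedDiracCore ⟨m.1 (h : H), hx⟩ = m.1 (T.D h) + N.nabla m (h : H) := by
  refine exists_apply_eq_of_mem_graph ?_
  rw [hN.graph_twistedDiracCore]
  exact N.apply_mem_twistedGraph h m

theorem IsHermitian.exists_isCommutator (hN : N.IsHermitian) (b : B) : ∃ C : HM →L[ℂ] HM,
    IsCommutator N.twistedDiracCore (ρ b) C ∧ IsCommutator N.twistedDirac (ρ b) C ∧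
      (∀ (h : H) (m : M.carrier), C (m.1 h) = m.1 (T.comm b h)) ∧ ‖C‖ ≤ ‖T.comm b‖ := by
  obtain ⟨C, hC, hCn⟩ := M.exists_clm_of_commute hN.adjoint_comp_mem
    (T.commute_comm_rightMul b) (fun b' => by
      rw [T.adjoint_comm]
      exact (T.commute_comm_rightMul (star b) b').neg_left)
  have hg : ∀ p ∈ N.twistedDiracCore.graph,
      (ρ b p.1, C p.1 + ρ b p.2) ∈ N.twistedDiracCore.graph := by
    rw [hN.graph_twistedDiracCore]
    exact fun p hp => N.π_mem_twistedGraph hC hp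
  exact ⟨C, isCommutator_of_graph hg, isCommutator_closure_of_graph hN.isClosable hg, hC, hCn⟩

end DConnection

end Twist

/-! ### Selfadjointness and compact resolvent through an intertwiner of dense range. -/

section Perturbation

variable {K : Type*} [NormedAddCommGroup K] [InnerProductSpace ℂ K] [CompleteSpace K]
variable {L : Type*} [NormedAddCommGroup L] [InnerProductSpace ℂ L] [CompleteSpace L]

/-- Let `A` be symmetric and densely defined on `L`, and let `V : K → L` be bounded with dense range.
If `(A - z) V S = V` and `(A - conj z) V S' = V` for compact operators `S` and `S'` on `K` and some
`z` that is not real, then the closure of `A` is selfadjoint with compact resolvent. -/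
theorem isSelfAdjoint_and_hasCompactResolvent_closure {A : L →ₗ.[ℂ] L}
    (hA : A.IsFormalAdjoint A) (hd : Dense (A.domain : Set L)) {V : K →L[ℂ] L}
    (hV : DenseRange V) {z : ℂ} (hz : z.im ≠ 0) {S S' : K →L[ℂ] K} (hSc : IsCompactOperator S)
    (hS : ∀ k, ∃ hx : V (S k) ∈ A.domain, A ⟨V (S k), hx⟩ - z • V (S k) = V k)
    (hS' : ∀ k, ∃ hx : V (S' k) ∈ A.domain, A ⟨V (S' k), hx⟩ - conj z • V (S' k) = V k) :
    IsSelfAdjoint A.closure ∧ HasCompactResolvent A.closure := by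
  have key : ∀ (w : ℂ) (S : K →L[ℂ] K), w.im ≠ 0 →
      (∀ k, ∃ hx : V (S k) ∈ A.domain, A ⟨V (S k), hx⟩ - w • V (S k) = V k) →
      ∃ R : L →L[ℂ] L, IsResolventAt A.closure w R ∧ ∀ k, R (V k) = V (S k) := by
    intro w S hw hS
    have hr : DenseRange fun x : A.domain => A x - w • (x : L) := by
      refine Dense.mono ?_ hV
      rintro _ ⟨k, rfl⟩
      obtain ⟨hx, hk⟩ := hS k
      exact ⟨⟨_, hx⟩, hk⟩
    obtain ⟨R, hR, -⟩ := exists_isResolventAt_closure hA hd hw hr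
    refine ⟨R, hR, fun k => ?_⟩
    obtain ⟨hx, hk⟩ := hS k
    have h1 := hR.2 ⟨V (S k), A.le_closure.1 hx⟩
    have h2 : A.closure ⟨V (S k), A.le_closure.1 hx⟩ = A ⟨V (S k), hx⟩ :=
      (A.le_closure.2 rfl).symm
    change R (A.closure ⟨V (S k), A.le_closure.1 hx⟩ - w • V (S k)) = V (S k) at h1
    rwa [h2, hk] at h1
  obtain ⟨R, hR, hRV⟩ := key z S hz hS
  obtain ⟨R', hR', hRV'⟩ := key (conj z) S' (by simpa using hz) hS'
  have hs := IsFormalAdjoint.closure hA (isClosable_of_isFormalAdjoint hA hd)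
  have hadj : ContinuousLinearMap.adjoint R = R' := by
    refine (ContinuousLinearMap.eq_adjoint_iff R' R).2 (fun x y => ?_) |>.symm
    rw [← inner_conj_symm, ← hR.inner_eq hs hR', inner_conj_symm]
  have hRc : IsCompactOperator R := by
    refine isCompactOperator_of_norm_le_on_orthogonal fun ε hε => ?_
    -- Krein's theorem needs a selfadjoint operator, hence `R* R` in place of `R`; the tolerance `ε
    -- ^ 2` becomes `ε` through `‖R x‖ ^ 2 = ⟪R* R x, x⟫`.
    obtain ⟨E, hE, hEB⟩ := exists_norm_le_on_orthogonal_of_symmetrizable hV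
      (A := S'.comp S) (hSc.clm_comp S') (IsSelfAdjoint.star_mul_self R)
      (fun k => by
        rw [ContinuousLinearMap.star_eq_adjoint, hadj, mul_apply_eq_comp, hRV, hRV']
        rfl) (pow_pos hε 2)
    refine ⟨E, hE, fun x hx => le_of_sq_le_sq ?_ (by positivity)⟩
    have h1 : (‖R x‖ : ℂ) ^ 2 = ⟪(star R * R) x, x⟫_ℂ := by
      rw [mul_apply_eq_comp, ContinuousLinearMap.star_eq_adjoint,
        ContinuousLinearMap.adjoint_inner_left]
      exact (inner_self_eq_norm_sq_to_K (𝕜 := ℂ) (R x)).symm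
    have h2 := norm_inner_le_norm (𝕜 := ℂ) ((star R * R) x) x
    rw [← h1, norm_pow, Complex.norm_real, norm_norm] at h2
    calc ‖R x‖ ^ 2 ≤ ε ^ 2 * ‖x‖ * ‖x‖ :=
          h2.trans (mul_le_mul_of_nonneg_right (hEB x hx) (norm_nonneg _))
      _ = (ε * ‖x‖) ^ 2 := by ring
  exact ⟨isSelfAdjoint_of_isResolventAt hs (hd.mono A.le_closure.1) hR hR',
    ⟨z, R, hR⟩, fun w R'' hR'' => hR.isCompactOperator hR'' hRc⟩

variable {H : Type*} [NormedAddCommGroup H] [InnerProductSpace ℂ H]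

/-- The inclusion of the `i`-th coordinate. -/
def coordInclusion {n : ℕ} (i : Fin n) : H →L[ℂ] PiLp 2 (fun _ : Fin n => H) :=
  ((PiLp.continuousLinearEquiv 2 ℂ (fun _ : Fin n => H)).symm :
    (Fin n → H) →L[ℂ] PiLp 2 (fun _ : Fin n => H)).comp
      (ContinuousLinearMap.single ℂ (fun _ : Fin n => H) i)

theorem coordInclusion_apply {n : ℕ} (i j : Fin n) (h : H) :
    (coordInclusion i h : PiLp 2 (fun _ : Fin n => H)) j = if j = i then h else 0 := by
  change (Pi.single i h : Fin n → H) j = _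
  rw [Pi.single_apply]

theorem sum_coordInclusion_apply {n : ℕ} (x : Fin n → H) (j : Fin n) :
    (∑ i, coordInclusion i (x i) : PiLp 2 (fun _ : Fin n => H)) j = x j := by
  change PiLp.proj (𝕜 := ℂ) 2 (fun _ : Fin n => H) j (∑ i, coordInclusion i (x i)) = x j
  rw [map_sum]
  change ∑ i, (coordInclusion i (x i) : PiLp 2 (fun _ : Fin n => H)) j = x j
  simp [coordInclusion_apply]

variable [CompleteSpace H]

/-- If `D` is selfadjoint with compact resolvent on `H` and `W` is bounded on `H ^ n`, then
`D + W - z` has a compact right inverse on `H ^ n` if the imaginary part of `z` is large. -/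
theorem exists_compact_right_inverse {D : H →ₗ.[ℂ] H} (hD : IsSelfAdjoint D)
    (hDc : HasCompactResolvent D) {n : ℕ}
    (W : PiLp 2 (fun _ : Fin n => H) →L[ℂ] PiLp 2 (fun _ : Fin n => H)) :
    ∃ r : ℝ, 0 < r ∧ ∀ z : ℂ, |z.im| = r →
      ∃ S : PiLp 2 (fun _ : Fin n => H) →L[ℂ] PiLp 2 (fun _ : Fin n => H), IsCompactOperator S ∧
        ∀ k i, ∃ hx : S k i ∈ D.domain, D ⟨S k i, hx⟩ + W (S k) i - z • S k i = k i := by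
  set c : ℝ := ∑ i : Fin n, ‖(coordInclusion i : H →L[ℂ] PiLp 2 (fun _ : Fin n => H))‖ *
    ‖PiLp.proj (𝕜 := ℂ) 2 (fun _ : Fin n => H) i‖ with hc
  have hc0 : 0 ≤ c := Finset.sum_nonneg fun i _ => by positivity
  -- The diagonal copy `G'` of the resolvent `G` has norm at most `c ‖G‖ ≤ c / |Im z|`, so this
  -- radius makes `‖W G'‖ < 1`.
  refine ⟨‖W‖ * c + 1, by positivity, fun z hz => ?_⟩
  have hr : 0 < ‖W‖ * c + 1 := by positivity
  have hz0 : z.im ≠ 0 := abs_pos.1 (hz ▸ hr)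
  obtain ⟨G, hG, hGn⟩ := exists_isResolventAt_of_isSelfAdjoint hD hz0
  have hGc := hDc.2 z G hG
  set G' : PiLp 2 (fun _ : Fin n => H) →L[ℂ] PiLp 2 (fun _ : Fin n => H) :=
    ∑ i, (coordInclusion i).comp (G.comp (PiLp.proj (𝕜 := ℂ) 2 (fun _ : Fin n => H) i)) with hG'
  have hG'i : ∀ x i, G' x i = G (x i) := by
    intro x i
    rw [hG', sum_apply]
    exact sum_coordInclusion_apply (fun i => G (x i)) i
  have hG'c : IsCompactOperator G' := by
    refine Submodule.sum_mem (compactOperator (RingHom.id ℂ) (PiLp 2 (fun _ : Fin n => H))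
      (PiLp 2 (fun _ : Fin n => H))) fun i _ => ?_
    exact (hGc.comp_clm (PiLp.proj (𝕜 := ℂ) 2 (fun _ : Fin n => H) i)).clm_comp (coordInclusion i)
  have hG'n : ‖G'‖ ≤ c * ‖G‖ := by
    rw [hc, Finset.sum_mul]
    refine (norm_sum_le _ _).trans (Finset.sum_le_sum fun i _ => ?_)
    refine (ContinuousLinearMap.opNorm_comp_le _ _).trans ?_
    rw [mul_assoc, mul_comm ‖PiLp.proj (𝕜 := ℂ) 2 (fun _ : Fin n => H) i‖]
    exact mul_le_mul_of_nonneg_left (ContinuousLinearMap.opNorm_comp_le _ _) (norm_nonneg _)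
  have hlt : ‖-(W * G')‖ < 1 := by
    rw [norm_neg]
    refine (norm_mul_le _ _).trans_lt ?_
    rw [hz] at hGn
    calc ‖W‖ * ‖G'‖ ≤ ‖W‖ * (c * (‖W‖ * c + 1)⁻¹) :=
          mul_le_mul_of_nonneg_left
            (hG'n.trans (mul_le_mul_of_nonneg_left hGn hc0)) (norm_nonneg _)
      _ = ‖W‖ * c / (‖W‖ * c + 1) := by rw [← mul_assoc, div_eq_mul_inv]
      _ < 1 := (div_lt_one hr).2 (lt_add_one _)
  set u := Units.oneSub (-(W * G')) hlt with hu
  -- Since `(D - z + W) G' = 1 + W G' = u`, the right inverse is `G' u⁻¹`.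
  refine ⟨G' * (u⁻¹ : (_)ˣ).val, hG'c.comp_clm (u⁻¹ : (_)ˣ).val, fun k i => ?_⟩
  set y := (u⁻¹ : (_)ˣ).val k with hy
  have hy1 : y + W (G' y) = k := by
    have h1 : (u.val * (u⁻¹ : (_)ˣ).val) k = k := by rw [Units.mul_inv]; rfl
    have h2 : u.val = 1 - -(W * G') := rfl
    rw [h2, sub_neg_eq_add] at h1
    exact h1
  change ∃ hx : G' y i ∈ D.domain, D ⟨G' y i, hx⟩ + W (G' y) i - z • G' y i = k i
  obtain ⟨hx, hGy⟩ := hG.1 (y i)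
  have hx' : G' y i ∈ D.domain := by rw [hG'i]; exact hx
  refine ⟨hx', ?_⟩
  have h1 : (⟨G' y i, hx'⟩ : D.domain) = ⟨G (y i), hx⟩ := Subtype.ext (hG'i y i)
  rw [h1, hG'i, add_sub_right_comm, hGy, ← hy1]
  rfl

end Perturbation

/-! ### Finitely generated modules. -/

section Twist

variable {B : Type*} [Ring B] [StarRing B] [Algebra ℂ B] [StarModule ℂ B]
variable {H : Type*} [NormedAddCommGroup H] [InnerProductSpace ℂ H] [CompleteSpace H]
variable {HM : Type*} [NormedAddCommGroup HM] [InnerProductSpace ℂ HM] [CompleteSpace HM]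
variable {T : RealSpectralTriple B H} {ρ : B →⋆ₐ[ℂ] (HM →L[ℂ] HM)}

namespace TwistModule

variable (M : TwistModule T ρ) {n : ℕ} {m : Fin n → M.carrier}

theorem exists_eq_sum_comp_rightMul (hm : Submodule.span B (Set.range m) = ⊤) (x : M.carrier) :
    ∃ b : Fin n → B, x.1 = ∑ k, (m k).1.comp (T.rightMul (b k)) := by
  obtain ⟨b, hb⟩ := (Submodule.mem_span_range_iff_exists_fun B).1
    (show x ∈ Submodule.span B (Set.range m) from hm ▸ Submodule.mem_top)
  refine ⟨b, ?_⟩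
  rw [← hb, AddSubmonoidClass.coe_finsetSum]
  rfl

theorem exists_eq_sum_comp_rightForm (hm : Submodule.span B (Set.range m) = ⊤)
    {x : H →L[ℂ] HM} (hx : x ∈ M.formsMul) :
    ∃ ω : Fin n → H →L[ℂ] H, (∀ k, ω k ∈ T.oneForms) ∧
      x = ∑ k, (m k).1.comp (T.rightForm (ω k)) := by
  induction hx using Submodule.span_induction with
  | mem x hx =>
    obtain ⟨ω, hω, m₀, hm₀, rfl⟩ := hx
    obtain ⟨b, hb⟩ := M.exists_eq_sum_comp_rightMul hm ⟨m₀, hm₀⟩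
    refine ⟨fun k => ω * T.π (b k), fun k => T.mul_π_mem_oneForms hω (b k), ?_⟩
    change m₀ = _ at hb
    rw [hb, ContinuousLinearMap.finsetSum_comp]
    refine Finset.sum_congr rfl fun k _ => ?_
    rw [T.rightForm_mul_π]
    rfl
  | zero => exact ⟨0, fun _ => zero_mem _, by simp [T.rightForm_zero]⟩
  | add x y _ _ hx hy =>
    obtain ⟨ω, hω, rfl⟩ := hx
    obtain ⟨η, hη, rfl⟩ := hy
    refine ⟨ω + η, fun k => add_mem (hω k) (hη k), ?_⟩
    simp only [Pi.add_apply, T.rightForm_add, ContinuousLinearMap.comp_add, Finset.sum_add_distrib]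
  | smul c x _ hx =>
    obtain ⟨ω, hω, rfl⟩ := hx
    refine ⟨c • ω, fun k => Submodule.smul_mem _ _ (hω k), ?_⟩
    simp only [Pi.smul_apply, T.rightForm_smul, ContinuousLinearMap.comp_smul, Finset.smul_sum]

end TwistModule

namespace DConnection

variable {M : TwistModule T ρ} {N : DConnection M} {n : ℕ} {m : Fin n → M.carrier}

theorem exists_eq_sum_of_mem_domain (hm : Submodule.span B (Set.range m) = ⊤) {x : HM}
    (hx : x ∈ N.twistedDiracCore.domain) :
    ∃ h : Fin n → T.D.domain, x = ∑ k, (m k).1 (h k : H) := by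
  rw [twistedDiracCore_domain] at hx
  induction hx using Submodule.span_induction with
  | mem x hx =>
    obtain ⟨h, m₀, rfl⟩ := hx
    obtain ⟨b, hb⟩ := M.exists_eq_sum_comp_rightMul hm m₀
    refine ⟨fun k => ⟨_, T.rightMul_mem_domain (b k) h.2⟩, ?_⟩
    rw [hb, sum_apply]
    rfl
  | zero => exact ⟨0, by simp⟩
  | add x y _ _ hx hy =>
    obtain ⟨h, rfl⟩ := hx
    obtain ⟨h', rfl⟩ := hy
    exact ⟨h + h', by simp [Finset.sum_add_distrib]⟩
  | smul c x _ hx =>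
    obtain ⟨h, rfl⟩ := hx
    exact ⟨c • h, by simp [Finset.smul_sum]⟩

/-- The pair is the sum of the generating pairs of the graph for `h k` and `m k`, so it does not
matter that the coefficients are not unique. -/
theorem IsHermitian.apply_sum (hN : N.IsHermitian) {ω : Fin n → Fin n → H →L[ℂ] H}
    (hω : ∀ j, N.nabla (m j) = ∑ k, (m k).1.comp (T.rightForm (ω j k)))
    (h : Fin n → T.D.domain) : ∃ hx : ∑ k, (m k).1 (h k : H) ∈ N.twistedDiracCore.domain,
      N.twistedDiracCore ⟨∑ k, (m k).1 (h k : H), hx⟩ =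
        ∑ k, (m k).1 (T.D (h k) + ∑ j, T.rightForm (ω j k) (h j : H)) := by
  refine exists_apply_eq_of_mem_graph ?_
  rw [hN.graph_twistedDiracCore]
  have h1 : (∑ k, (m k).1 (h k : H),
      ∑ k, (m k).1 (T.D (h k) + ∑ j, T.rightForm (ω j k) (h j : H))) =
      ∑ k, ((m k).1 (h k : H), (m k).1 (T.D (h k)) + N.nabla (m k) (h k : H)) := by
    refine Prod.ext ?_ ?_
    · rw [Prod.fst_sum]
    · rw [Prod.snd_sum]
      simp only [map_add, map_sum, Finset.sum_add_distrib, hω, sum_apply,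
        ContinuousLinearMap.comp_apply]
      rw [Finset.sum_comm]
  rw [h1]
  exact Submodule.sum_mem _ fun k _ => N.apply_mem_twistedGraph (h k) (m k)

theorem IsHermitian.isSelfAdjoint_and_hasCompactResolvent (hN : N.IsHermitian)
    (hm : Submodule.span B (Set.range m) = ⊤) {ω : Fin n → Fin n → H →L[ℂ] H}
    (hω : ∀ j, N.nabla (m j) = ∑ k, (m k).1.comp (T.rightForm (ω j k))) :
    IsSelfAdjoint N.twistedDirac ∧ HasCompactResolvent N.twistedDirac := by
  set p : Fin n → PiLp 2 (fun _ : Fin n => H) →L[ℂ] H :=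
    fun i => PiLp.proj (𝕜 := ℂ) 2 (fun _ : Fin n => H) i with hp
  set V : PiLp 2 (fun _ : Fin n => H) →L[ℂ] HM := ∑ i, (m i).1.comp (p i) with hVdef
  have hVx : ∀ x, V x = ∑ i, (m i).1 (x i) := fun x => by rw [hVdef, sum_apply]; rfl
  have hV : DenseRange V := by
    have h1 : Dense (LinearMap.range V.toLinearMap : Set HM) := by
      refine M.dense.mono (Submodule.span_le.2 ?_)
      rintro _ ⟨h, m₀, rfl⟩
      obtain ⟨b, hb⟩ := M.exists_eq_sum_comp_rightMul hm m₀
      refine ⟨∑ i, coordInclusion i (T.rightMul (b i) h), ?_⟩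
      change V _ = _
      rw [hVx, hb, sum_apply]
      refine Finset.sum_congr rfl fun i _ => ?_
      rw [sum_coordInclusion_apply (fun i => T.rightMul (b i) h)]
      rfl
    exact h1
  -- Chosen so that `D_M V = V (D + W)`: the `k`-th entry collects the coefficients of `m k` in all
  -- `∇(m j)`.
  set W : PiLp 2 (fun _ : Fin n => H) →L[ℂ] PiLp 2 (fun _ : Fin n => H) :=
    ∑ k, (coordInclusion k).comp (∑ j, (T.rightForm (ω j k)).comp (p j)) with hWdef
  have hW : ∀ x k, W x k = ∑ j, T.rightForm (ω j k) (x j) := by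
    intro x k
    rw [hWdef, sum_apply]
    refine (sum_coordInclusion_apply
      (fun k => (∑ j, (T.rightForm (ω j k)).comp (p j)) x) k).trans ?_
    rw [sum_apply]
    rfl
  obtain ⟨r, hr, hS⟩ := exists_compact_right_inverse T.selfAdjoint T.compactResolvent W
  have key : ∀ (z : ℂ) (S : PiLp 2 (fun _ : Fin n => H) →L[ℂ] PiLp 2 (fun _ : Fin n => H)),
      (∀ k i, ∃ hx : S k i ∈ T.D.domain, T.D ⟨S k i, hx⟩ + W (S k) i - z • S k i = k i) →
      ∀ k, ∃ hx : V (S k) ∈ N.twistedDiracCore.domain,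
        N.twistedDiracCore ⟨V (S k), hx⟩ - z • V (S k) = V k := by
    intro z S hS k
    choose hx hk using hS k
    obtain ⟨hd, hv⟩ := hN.apply_sum hω (fun i => ⟨S k i, hx i⟩)
    have h1 : V (S k) = ∑ i, (m i).1 (S k i) := hVx (S k)
    have hd' : V (S k) ∈ N.twistedDiracCore.domain := h1 ▸ hd
    refine ⟨hd', ?_⟩
    have h2 : (⟨V (S k), hd'⟩ : N.twistedDiracCore.domain) = ⟨_, hd⟩ := Subtype.ext h1
    rw [h2, hv, h1, hVx, Finset.smul_sum, ← Finset.sum_sub_distrib]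
    refine Finset.sum_congr rfl fun i _ => ?_
    rw [← map_smul, ← map_sub, ← hW, hk]
  obtain ⟨S, hSc, hS1⟩ := hS (r * Complex.I) (by simp [abs_of_pos hr])
  obtain ⟨S', -, hS1'⟩ := hS (conj (r * Complex.I)) (by simp [abs_of_pos hr])
  exact isSelfAdjoint_and_hasCompactResolvent_closure hN.isFormalAdjoint
    N.dense_twistedDiracCore_domain hV (z := r * Complex.I) (by simpa using hr.ne') hSc
    (key _ S hS1) (key _ S' hS1')

end DConnection

end Twist

end NCTwist

end

theorem mainTheorem2
    {B : Type*} [Ring B] [StarRing B] [Algebra ℂ B] [StarModule ℂ B]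
    {H : Type*} [NormedAddCommGroup H] [InnerProductSpace ℂ H] [CompleteSpace H]
    {HM : Type*} [NormedAddCommGroup HM] [InnerProductSpace ℂ HM] [CompleteSpace HM]
    (T : NCTwist.RealSpectralTriple B H) (ρ : B →⋆ₐ[ℂ] (HM →L[ℂ] HM))
    (M : NCTwist.TwistModule T ρ) (N : NCTwist.DConnection M) (hN : N.IsHermitian) :
    -- the operator on `Dom(D) M` is well defined by the formula, densely defined, symmetric, closable
    (N.twistedDiracCore.domain =
        Submodule.span ℂ {x : HM | ∃ (h : T.D.domain) (m : M.carrier), x = m.1 (h : H)} ∧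
      (∀ (h : T.D.domain) (m : M.carrier), ∃ hx : m.1 (h : H) ∈ N.twistedDiracCore.domain,
        N.twistedDiracCore ⟨m.1 (h : H), hx⟩ = m.1 (T.D h) + N.nabla m (h : H)) ∧
      Dense (N.twistedDiracCore.domain : Set HM) ∧
      N.twistedDiracCore.IsFormalAdjoint N.twistedDiracCore ∧
      N.twistedDiracCore.IsClosable) ∧
    -- bounded commutators, for the operator on `Dom(D) M` and for its closure `D_M`
    (∀ b : B, ∃ C : HM →L[ℂ] HM,
      NCTwist.IsCommutator N.twistedDiracCore (ρ b) C ∧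
      NCTwist.IsCommutator N.twistedDirac (ρ b) C ∧
      (∀ (h : H) (m : M.carrier), C (m.1 h) = m.1 (T.comm b h)) ∧
      ‖C‖ ≤ ‖T.comm b‖) ∧
    -- the case of a finitely generated module
    (Module.Finite B M.carrier →
      IsSelfAdjoint N.twistedDirac ∧
      NCTwist.HasCompactResolvent N.twistedDirac ∧
      -- in terms of generators, `D_M` is `D` plus a bounded matrix of one-forms
      ∀ (n : ℕ) (m : Fin n → M.carrier), Submodule.span B (Set.range m) = ⊤ →
        ∃ ω : Fin n → Fin n → H →L[ℂ] H,
          (∀ j k, ω j k ∈ T.oneForms) ∧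
          (∀ j, N.nabla (m j) = ∑ k, (m k).1.comp (T.rightForm (ω j k))) ∧
          (∀ x ∈ N.twistedDiracCore.domain,
            ∃ h : Fin n → T.D.domain, x = ∑ k, (m k).1 (h k : H)) ∧
          ∀ h : Fin n → T.D.domain,
            ∃ hx : ∑ k, (m k).1 (h k : H) ∈ N.twistedDiracCore.domain,
              N.twistedDiracCore ⟨∑ k, (m k).1 (h k : H), hx⟩ =
                ∑ k, (m k).1 (T.D (h k) + ∑ j, T.rightForm (ω j k) (h j : H))) := by
  refine ⟨⟨N.twistedDiracCore_domain, hN.apply, N.dense_twistedDiracCore_domain,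
    hN.isFormalAdjoint, hN.isClosable⟩, hN.exists_isCommutator, fun hfin => ?_⟩
  have hgen : ∀ (n : ℕ) (m : Fin n → M.carrier), Submodule.span B (Set.range m) = ⊤ →
      ∃ ω : Fin n → Fin n → H →L[ℂ] H, (∀ j k, ω j k ∈ T.oneForms) ∧
        ∀ j, N.nabla (m j) = ∑ k, (m k).1.comp (T.rightForm (ω j k)) := by
    intro n m hm
    choose ω hω1 hω2 using fun j => M.exists_eq_sum_comp_rightForm hm (N.nabla_mem (m j))
    exact ⟨ω, hω1, hω2⟩
  obtain ⟨n, m, hm⟩ := Module.Finite.exists_fin (R := B) (M := M.carrier)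
  obtain ⟨ω, -, hω⟩ := hgen n m hm
  obtain ⟨hsa, hcr⟩ := hN.isSelfAdjoint_and_hasCompactResolvent hm hω
  refine ⟨hsa, hcr, fun n m hm => ?_⟩
  obtain ⟨ω, hω1, hω⟩ := hgen n m hm
  exact ⟨ω, hω1, hω, fun x hx => NCTwist.DConnection.exists_eq_sum_of_mem_domain hm hx,
    hN.apply_sum hω⟩
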